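/- Let $\mathbb S^1=\mathbb R/\mathbb Z$, let $\mathrm{Homeo}_+(\mathbb S^1)$ be its group of orientation-preserving homeomorphisms, $\mathrm{rot}(f)\in\mathbb R/\mathbb Z$ the rotation number, and $d(f,g)=\sup_x \mathrm{dist}(f(x),g(x))$ the uniform distance; $f,g$ are $\varepsilon$-close if $d(f,g)<\varepsilon$. **Combinatorial groups.** Let $D_0\subset\mathbb S^1$ be dense. A subgroup $G_0\subset\mathrm{Homeo}_+(\mathbb S^1)$ is *$D_0$-combinatorial* if: (C1) $D_0$ is $G_0$-invariant; (C2) for every $n$ and all circularly ordered $n$-tuples $(x_i)$, $(y_i)$ of distinct points of $D_0$ there is $g\in G_0$ with $g(x_i)=y_i$ for all $i$; (C3) for every $q\ge 1$, $G_0$ contains an element of order $q$; (C4) for all $a,b\in G_0$ of the same finite order $q$ and the same rotation number, and every finite $E\subset D_0$ with $a^k|_E=b^k|_E$ for $1\le k\le q-1$, there is $h\in G_0$ with $b=hah^{-1}$ and $h|_E=\mathrm{id}_E$. Moreover, for every such $a$ and $E$ and every $\varepsilon>0$ there is $\delta>0$ such that, if in addition $d(a,b)<\delta$, then $h$ can be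 chosen with $d(h,\mathrm{id})<\varepsilon$. **Markings.** A *marking* $(\alpha,T)$ of a group $G$ (finitely generated and virtually free) consists of an action $\alpha$ of $G$ by automorphisms, without inversions and with finite vertex stabilizers, on a locally finite simplicial tree $X$, and of a bounded fundamental domain $T$. Here $T$ is given by a finite subtree of $X$, spanned by a set $V$ containing exactly one vertex of each $G$-orbit of vertices, together with the initial half-edges of a set $E$ of oriented edges with origin in $V$ that contains exactly one oriented edge of each $G$-orbit of oriented edges and all the oriented edges of the subtree. For $v\in V$ let $G_v$ be the stabilizer of $v$. For $s\in E$ with target not in $V$, let $s'\in E$ be the representative of the orbit of the reverse of $s$; the elements of $G$ mapping the reverse of $s'$ to $s$ form a coset of the stabilizer $A_s$ of $s$ (the coset $\alpha_s(A_s)s$ of stable letters in the presentation of $G$ as the fundamental group of the graph of groups $X/G$). The *system of generators* $\mathcal G$ of the marking is the union of all the groups $G_v$, $v\in V$, and all these cosets. **Proposition.** Let $D_0\subset\mathbb S^1$ be dense, let $G_0\subset\mathrm{Homeo}_+(\mathbb S^1)$ be $D_0$-combinatorial, and let $G\subset\mathrm{Homeo}_+(\mathbb S^1)$ be a finitely generated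 virtually free subgroup with a marking $(\alpha,T)$ and associated system of generators $\mathcal G$. Then for every $\varepsilon>0$ and every finite subset $P\subset D_0$ such that $\mathcal G^2(P)=\{s(t(p)) : s,t\in\mathcal G,\ p\in P\}\subset D_0$, there is a homomorphism $\pi:G\to G_0$ such that: 1. for every $s\in\mathcal G$, $s$ and $\pi(s)$ have the same (possibly infinite) order, and $\mathrm{rot}(\pi(s))=\mathrm{rot}(s)$ whenever $\mathrm{rot}(s)$ is rational; 2. for every $s\in\mathcal G$, $\pi(s)$ and $s$ are $\varepsilon$-close; 3. $\pi(s)|_P=s|_P$ for every $s\in\mathcal G$; moreover, if $s\in G_v$ for some $v\in V$, then $\pi(s)|_{G_v(P)}=s|_{G_v(P)}$. -/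

import Mathlib

/-!
# Combinatorial groups of circle homeomorphisms and marked virtually free groups

The circle is `UnitAddCircle = ℝ / ℤ`, with its usual topology, metric and circular order.
-/

/-- The group `Homeo₊(𝕊¹)` of orientation-preserving homeomorphisms of the circle `ℝ / ℤ`:
the homeomorphisms that lift to an increasing homeomorphism of `ℝ` commuting with integer
translations. (The units of the monoid `CircleDeg1Lift` are exactly the elements of the group
`Homeo_ℤ(ℝ)` of increasing homeomorphisms of `ℝ` commuting with integer translations.) -/
def HomeoPlus : Subgroup (UnitAddCircle ≃ₜ UnitAddCircle) where
  carrier := {f | ∃ F : CircleDeg1Liftˣ,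
    ∀ x : ℝ, f (x : UnitAddCircle) = ((F x : ℝ) : UnitAddCircle)}
  mul_mem' := by
    rintro f g ⟨F, hF⟩ ⟨K, hK⟩
    refine ⟨F * K, fun x => ?_⟩
    change f (g x) = _
    rw [hK, hF]
    rfl
  one_mem' := ⟨1, fun _ => rfl⟩
  inv_mem' := by
    rintro f ⟨F, hF⟩
    refine ⟨F⁻¹, fun x => ?_⟩
    change f.symm x = _
    rw [Homeomorph.symm_apply_eq, hF, CircleDeg1Lift.units_apply_inv_apply]

namespace HomeoPlus

/-- Elements of `HomeoPlus` are applied to points of the circle as functions. -/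
instance : CoeFun HomeoPlus (fun _ => UnitAddCircle → UnitAddCircle) :=
  ⟨fun f => (f : UnitAddCircle ≃ₜ UnitAddCircle)⟩

/-- `F ∈ Homeo_ℤ(ℝ)` is a lift of `f ∈ Homeo₊(𝕊¹)`. -/
def IsLift (F : CircleDeg1Liftˣ) (f : HomeoPlus) : Prop :=
  ∀ x : ℝ, f (x : UnitAddCircle) = ((F x : ℝ) : UnitAddCircle)

theorem exists_isLift (f : HomeoPlus) : ∃ F : CircleDeg1Liftˣ, IsLift F f := f.2

/-- The rotation number `rot(f) ∈ ℝ / ℤ` of `f ∈ Homeo₊(𝕊¹)`: the class modulo `ℤ` of the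
translation number `lim (Fⁿ(x) - x) / n` of a lift `F` of `f`. It does not depend on the lift,
see `rot_eq_of_isLift`. -/
noncomputable def rot (f : HomeoPlus) : UnitAddCircle :=
  ((CircleDeg1Lift.translationNumber
    ((exists_isLift f).choose : CircleDeg1Lift) : ℝ) : UnitAddCircle)

theorem translationNumber_congr {f : HomeoPlus} {F F' : CircleDeg1Liftˣ} (h : IsLift F f)
    (h' : IsLift F' f) :
    ((CircleDeg1Lift.translationNumber (F : CircleDeg1Lift) : ℝ) : UnitAddCircle) =
      ((CircleDeg1Lift.translationNumber (F' : CircleDeg1Lift) : ℝ) : UnitAddCircle) := by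
  have hc : ∀ K : CircleDeg1Liftˣ, Continuous (fun x : ℝ => K x) := fun K =>
    (CircleDeg1Lift.toOrderIso K).continuous
  have hz : ∀ x : ℝ, ∃ n : ℤ, (n : ℝ) = F x - F' x := by
    intro x
    have h1 : ((F x : ℝ) : UnitAddCircle) = ((F' x : ℝ) : UnitAddCircle) := by
      rw [← h x, ← h' x]
    rw [← sub_eq_zero, ← AddCircle.coe_sub, AddCircle.coe_eq_zero_iff] at h1
    obtain ⟨n, hn⟩ := h1
    exact ⟨n, by simpa using hn⟩
  choose n hn using hz
  have hcn : Continuous n := by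
    have h1 : Continuous (fun x : ℝ => ((n x : ℤ) : ℝ)) := by
      simp only [hn]
      exact (hc F).sub (hc F')
    exact Int.isClosedEmbedding_coe_real.isInducing.continuous_iff.2 h1
  have hconst : ∀ x, n x = n 0 := fun x =>
    PreconnectedSpace.constant inferInstance hcn
  have hF : (F : CircleDeg1Lift) =
      (CircleDeg1Lift.translate (Multiplicative.ofAdd ((n 0 : ℤ) : ℝ)) : CircleDeg1Lift) * F' := by
    ext x
    have h1 := hn x
    rw [hconst x] at h1
    change F x = CircleDeg1Lift.translate (Multiplicative.ofAdd ((n 0 : ℤ) : ℝ)) (F' x)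
    rw [CircleDeg1Lift.translate_apply]
    linarith
  have hcomm : Commute
      (CircleDeg1Lift.translate (Multiplicative.ofAdd ((n 0 : ℤ) : ℝ)) : CircleDeg1Lift) F' := by
    ext x
    change CircleDeg1Lift.translate (Multiplicative.ofAdd ((n 0 : ℤ) : ℝ)) (F' x) =
      F' (CircleDeg1Lift.translate (Multiplicative.ofAdd ((n 0 : ℤ) : ℝ)) x)
    rw [CircleDeg1Lift.translate_apply, CircleDeg1Lift.translate_apply]
    exact ((F' : CircleDeg1Lift).map_int_add (n 0) x).symm
  rw [hF, CircleDeg1Lift.translationNumber_mul_of_commute hcomm,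
    CircleDeg1Lift.translationNumber_translate, AddCircle.coe_add]
  have h0 : (((n 0 : ℤ) : ℝ) : UnitAddCircle) = 0 := by
    rw [AddCircle.coe_eq_zero_iff]
    exact ⟨n 0, by simp⟩
  rw [h0, zero_add]

theorem rot_eq_of_isLift {f : HomeoPlus} {F : CircleDeg1Liftˣ} (h : IsLift F f) :
    rot f = ((CircleDeg1Lift.translationNumber (F : CircleDeg1Lift) : ℝ) : UnitAddCircle) :=
  translationNumber_congr (exists_isLift f).choose_spec h

/-- The rotation number of `f` is rational, i.e. it is the class of a rational number. -/
def HasRationalRot (f : HomeoPlus) : Prop :=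
  ∃ r : ℚ, rot f = ((r : ℝ) : UnitAddCircle)

/-- The uniform distance `sup_x dist (f x) (g x)` on `Homeo₊(𝕊¹)`, as the distance in the
metric space of continuous maps of the compact circle. -/
noncomputable def uniformDist (f g : HomeoPlus) : ℝ :=
  dist (⟨f, f.1.continuous⟩ : C(UnitAddCircle, UnitAddCircle))
    (⟨g, g.1.continuous⟩ : C(UnitAddCircle, UnitAddCircle))

end HomeoPlus

/-- An `n`-tuple of distinct points of the circle that are met in this order when the circle is
traversed once in the positive direction. -/
def CircularlyOrdered {n : ℕ} (x : Fin n → UnitAddCircle) : Prop :=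
  Function.Injective x ∧ ∀ i j k : Fin n, i < j → j < k → sbtw (x i) (x j) (x k)

/-- `D₀`-combinatorial subgroups of `Homeo₊(𝕊¹)`. -/
structure IsCombinatorial (D₀ : Set UnitAddCircle) (G₀ : Subgroup HomeoPlus) : Prop where
  /-- `D₀` is invariant under `G₀`. -/
  invariance : ∀ g ∈ G₀, ∀ x ∈ D₀, g x ∈ D₀
  /-- Interpolation of circularly ordered tuples of points of `D₀`. -/
  interpolation : ∀ (n : ℕ) (x y : Fin n → UnitAddCircle),
    CircularlyOrdered x → CircularlyOrdered y → (∀ i, x i ∈ D₀) → (∀ i, y i ∈ D₀) →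
      ∃ g ∈ G₀, ∀ i, g (x i) = y i
  /-- `G₀` has elements of every finite order. -/
  order : ∀ q : ℕ, 0 < q → ∃ g ∈ G₀, orderOf g = q
  /-- Two elements of the same finite order `q` and the same rotation number, whose powers
  coincide on the finite set `E ⊆ D₀`, are conjugate by an element of `G₀` fixing `E`. -/
  conjugation : ∀ (q : ℕ), 0 < q → ∀ a ∈ G₀, ∀ b ∈ G₀, orderOf a = q → orderOf b = q →
    HomeoPlus.rot a = HomeoPlus.rot b →
    ∀ E : Set UnitAddCircle, E.Finite → E ⊆ D₀ →
      (∀ k : ℕ, 1 ≤ k → k ≤ q - 1 → ∀ x ∈ E, (a ^ k) x = (b ^ k) x) →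
      ∃ h ∈ G₀, b = h * a * h⁻¹ ∧ ∀ x ∈ E, h x = x
  /-- If moreover `b` is close enough to `a`, the conjugating element can be taken close to the
  identity. -/
  conjugation_close : ∀ (q : ℕ), 0 < q → ∀ a ∈ G₀, orderOf a = q →
    ∀ E : Set UnitAddCircle, E.Finite → E ⊆ D₀ → ∀ ε : ℝ, 0 < ε → ∃ δ : ℝ, 0 < δ ∧
      ∀ b ∈ G₀, orderOf b = q → HomeoPlus.rot a = HomeoPlus.rot b →
        (∀ k : ℕ, 1 ≤ k → k ≤ q - 1 → ∀ x ∈ E, (a ^ k) x = (b ^ k) x) →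
        HomeoPlus.uniformDist a b < δ →
        ∃ h ∈ G₀, b = h * a * h⁻¹ ∧ (∀ x ∈ E, h x = x) ∧ HomeoPlus.uniformDist h 1 < ε

/-- A marking `(α, T)` of a (finitely generated, virtually free) group `G`: a proper action `α`
of `G` on a locally finite simplicial tree `X` (with vertex set `V`), by automorphisms and
without inversions of edges, together with a bounded fundamental domain `T`.

The fundamental domain `T` consists of a finite subtree of `X`, spanned by a set `verts` of
representatives of the vertex orbits, together with all the initial half-edges of a set `edges` of
representatives of the orbits of oriented edges, whose origins are in `verts`. An oriented edge is
represented by the pair (origin, target). So the vertices of the quotient graph `X / G`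
correspond to `verts`, its oriented edges to `edges`, and the edges of the subtree map onto a
spanning tree of `X / G`. -/
structure Marking (G : Type*) [Group G] (V : Type*) where
  /-- the tree `X` -/
  tree : SimpleGraph V
  isTree : tree.IsTree
  locallyFinite : ∀ x : V, (tree.neighborSet x).Finite
  /-- the action `α` -/
  action : G →* (tree ≃g tree)
  no_inversion : ∀ (g : G) (x y : V), tree.Adj x y → ¬ (action g x = y ∧ action g y = x)
  finite_stabilizers : ∀ x : V, {g : G | action g x = x}.Finite
  /-- the vertices of `T` -/
  verts : Set V
  verts_finite : verts.Finite
  verts_transversal : ∀ x : V, ∃! v : V, v ∈ verts ∧ ∃ g : G, action g v = x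
  verts_connected : (tree.induce verts).Connected
  /-- the oriented edges whose initial half is in `T` -/
  edges : Set (V × V)
  edges_adj : ∀ e ∈ edges, tree.Adj e.1 e.2
  edges_origin : ∀ e ∈ edges, e.1 ∈ verts
  edges_transversal : ∀ x y : V, tree.Adj x y →
    ∃! e : V × V, e ∈ edges ∧ ∃ g : G, action g e.1 = x ∧ action g e.2 = y
  edges_subtree : ∀ x ∈ verts, ∀ y ∈ verts, tree.Adj x y → (x, y) ∈ edges

namespace Marking

variable {G : Type*} [Group G] {V : Type*}

/-- The vertex group `G_v`, as the stabilizer of the vertex `v` of the tree. -/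
def vertexGroup (M : Marking G V) (v : V) : Subgroup G where
  carrier := {g | M.action g v = v}
  mul_mem' := by
    intro g h hg hh
    change M.action (g * h) v = v
    rw [map_mul, RelIso.mul_apply]
    exact (congrArg _ hh).trans hg
  one_mem' := by simp
  inv_mem' := by
    intro g hg
    change M.action g⁻¹ v = v
    rw [map_inv]
    exact (RelIso.symm_apply_eq (M.action g)).2 (Eq.symm hg)

/-- The coset `α_s(A_s) s` associated with an oriented edge `s` of the quotient graph that is not
in the spanning tree. The edge `s` has a representative `e ∈ edges`, whose target is not in
`verts`, and its reverse has a representative `e' ∈ edges`. A stable letter for `s` is an element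
of `G` that maps the reverse of `e'` to `e`. Such elements form the coset `α_s(A_s) s` of any one
of them, where `α_s(A_s)` is the stabilizer of `e`. -/
def stableLetters (M : Marking G V) (e : V × V) : Set G :=
  {g | ∃ e' ∈ M.edges, M.action g e'.2 = e.1 ∧ M.action g e'.1 = e.2}

/-- The preferred system of generators `𝒢 = {G_v, α_s(A_s) s}`, where `v` runs over the
vertices and `s` over the oriented edges of the quotient graph that are not in the spanning
tree. -/
def gens (M : Marking G V) : Set G :=
  {g | (∃ v ∈ M.verts, g ∈ M.vertexGroup v) ∨
    ∃ e ∈ M.edges, e.2 ∉ M.verts ∧ g ∈ M.stableLetters e}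

end Marking

/-! By Bass–Serre theory `G` is the fundamental group of a graph of finite groups. A homomorphism
out of it amounts to homomorphisms on the vertex groups that agree across the subtree, together with
an image for each stable letter that intertwines the two embeddings of its edge group
(`Marking.IsCompatible.exists_hom`). These data have to be found in `G₀` with prescribed values at
finitely many points.

Finite groups are rigid: averaging lifts conjugates them to rotations (`exists_linearization`), so
the faithful ones are cyclic, and an element of finite order is determined up to conjugacy by its
rotation number. Hence `G₀` contains copies of the vertex groups with the right rotation numbers and
the right values on finite subsets of `D₀` (`exists_finite_order_agree`). The conjugation axiom
makes two copies of a cyclic group coincide without disturbing prescribed values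
(`exists_conj_agree`). This propagates the vertex homomorphisms along the subtree and yields the
images of the stable letters.

A stable letter leaving the subtree has infinite order, and so must its image. The image is
multiplied by an element centralizing the edge group and fixing the prescribed points, which leaves
one orbit in place and pushes another one forward; no homeomorphism of finite order results
(`exists_commute_forall_orderOf_eq_zero`).

The construction needs long orbits inside `D₀`, also of auxiliary points that control closeness and
rotation numbers. So `G` is first conjugated by some `φ` close to the identity, which fixes the
points already known to be in `D₀` and moves the others into it (`exists_move`). Agreement on a fine
sample gives closeness by monotonicity; agreement on a finite orbit gives the rational rotation
numbers. -/

namespace HomeoPlus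

/-! ### Lifts, rotation numbers and interpolation at finitely many points -/

theorem mul_apply (f g : HomeoPlus) (x : UnitAddCircle) : (f * g) x = f (g x) := rfl

theorem one_apply (x : UnitAddCircle) : (1 : HomeoPlus) x = x := rfl

theorem inv_apply_self (f : HomeoPlus) (x : UnitAddCircle) : f⁻¹ (f x) = x := by
  rw [← mul_apply, inv_mul_cancel, one_apply]

theorem apply_inv_self (f : HomeoPlus) (x : UnitAddCircle) : f (f⁻¹ x) = x := by
  rw [← mul_apply, mul_inv_cancel, one_apply]

theorem injective (f : HomeoPlus) : Function.Injective f := f.1.injective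

theorem continuous (f : HomeoPlus) : Continuous f := f.1.continuous

theorem ext_apply {f g : HomeoPlus} (h : ∀ x, f x = g x) : f = g :=
  Subtype.ext (Homeomorph.ext h)

theorem inv_apply_eq {f : HomeoPlus} {x y : UnitAddCircle} : f⁻¹ x = y ↔ x = f y :=
  ⟨fun h => by rw [← h, apply_inv_self], fun h => by rw [h, inv_apply_self]⟩

theorem pow_succ_apply (f : HomeoPlus) (n : ℕ) (x : UnitAddCircle) :
    (f ^ (n + 1)) x = f ((f ^ n) x) := by
  rw [pow_succ', mul_apply]

theorem IsLift.one : IsLift 1 1 := fun _ => rfl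

theorem IsLift.mul {F K : CircleDeg1Liftˣ} {f k : HomeoPlus} (hF : IsLift F f)
    (hK : IsLift K k) : IsLift (F * K) (f * k) := fun x => by
  rw [mul_apply, hK, hF]; rfl

theorem IsLift.inv {F : CircleDeg1Liftˣ} {f : HomeoPlus} (hF : IsLift F f) :
    IsLift F⁻¹ f⁻¹ := fun x => by
  rw [inv_apply_eq, hF, CircleDeg1Lift.units_apply_inv_apply]

theorem IsLift.pow {F : CircleDeg1Liftˣ} {f : HomeoPlus} (hF : IsLift F f) (n : ℕ) :
    IsLift (F ^ n) (f ^ n) := by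
  induction n with
  | zero => simpa using IsLift.one
  | succ n ih => simpa [pow_succ] using ih.mul hF

theorem coe_eq_coe_iff {s t : ℝ} :
    (s : UnitAddCircle) = (t : UnitAddCircle) ↔ ∃ n : ℤ, s = t + n := by
  rw [← sub_eq_zero, ← AddCircle.coe_sub, AddCircle.coe_eq_zero_iff]
  constructor
  · rintro ⟨n, hn⟩
    exact ⟨n, by simp at hn; linarith⟩
  · rintro ⟨n, hn⟩
    exact ⟨n, by simp; linarith⟩

theorem coe_int (n : ℤ) : ((n : ℝ) : UnitAddCircle) = 0 :=
  AddCircle.coe_eq_zero_iff (p := (1 : ℝ)).2 ⟨n, by simp⟩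

theorem strictMono (F : CircleDeg1Liftˣ) : StrictMono F :=
  (CircleDeg1Lift.toOrderIso F).strictMono

theorem continuous_unit (F : CircleDeg1Liftˣ) : Continuous F :=
  (CircleDeg1Lift.toOrderIso F).continuous

/-- The circle homeomorphism with a given lift. -/
noncomputable def ofLift (F : CircleDeg1Liftˣ) : HomeoPlus := by
  have hper : ∀ K : CircleDeg1Liftˣ,
      Function.Periodic (fun t : ℝ => ((K t : ℝ) : UnitAddCircle)) 1 := fun K t => by
    have : K (t + 1) = K t + 1 := (K : CircleDeg1Lift).map_add_one t
    simp only [this]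
    exact AddCircle.coe_add_period 1 _
  have hcont : ∀ K : CircleDeg1Liftˣ, Continuous (hper K).lift := fun K =>
    continuous_coinduced_dom.2 ((AddCircle.continuous_mk' 1).comp (continuous_unit K))
  have hinv : ∀ K L : CircleDeg1Liftˣ, (∀ t, K (L t) = t) →
      ∀ x, (hper K).lift ((hper L).lift x) = x := fun K L h x => by
    obtain ⟨t, rfl⟩ := QuotientAddGroup.mk_surjective x
    change ((K (L t) : ℝ) : UnitAddCircle) = t
    rw [h]
  exact ⟨{ toFun := (hper F).lift
           invFun := (hper F⁻¹).lift
           left_inv := hinv _ _ (CircleDeg1Lift.units_inv_apply_apply F)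
           right_inv := hinv _ _ (CircleDeg1Lift.units_apply_inv_apply F)
           continuous_toFun := hcont F
           continuous_invFun := hcont F⁻¹ }, F, fun _ => rfl⟩

theorem isLift_ofLift (F : CircleDeg1Liftˣ) : IsLift F (ofLift F) := fun _ => rfl

theorem isLift_translate_mul {F : CircleDeg1Liftˣ} {f : HomeoPlus} (hF : IsLift F f) (n : ℤ) :
    IsLift (CircleDeg1Lift.translate (Multiplicative.ofAdd (n : ℝ)) * F) f := fun x => by
  rw [hF]
  change _ = ((CircleDeg1Lift.translate (Multiplicative.ofAdd (n : ℝ)) (F x) : ℝ) : UnitAddCircle)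
  rw [CircleDeg1Lift.translate_apply, AddCircle.coe_add, coe_int, zero_add]

/-- Two lifts of the same homeomorphism differ by an integer translation. -/
theorem IsLift.exists_int {F K : CircleDeg1Liftˣ} {f : HomeoPlus} (hF : IsLift F f)
    (hK : IsLift K f) : ∃ n : ℤ, ∀ t, F t = K t + n := by
  obtain ⟨n, hn⟩ := coe_eq_coe_iff.1 ((hF 0).symm.trans (hK 0))
  refine ⟨n, fun t => ?_⟩
  have hz : ∀ x : ℝ, ∃ n : ℤ, F x = K x + n := fun x =>
    coe_eq_coe_iff.1 ((hF x).symm.trans (hK x))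
  choose m hm using hz
  have hc : Continuous m := by
    have h1 : Continuous (fun x : ℝ => ((m x : ℤ) : ℝ)) := by
      have : (fun x : ℝ => ((m x : ℤ) : ℝ)) = fun x => F x - K x := by
        funext x; rw [hm x]; ring
      rw [this]
      exact (continuous_unit F).sub (continuous_unit K)
    exact Int.isClosedEmbedding_coe_real.isInducing.continuous_iff.2 h1
  have h0 : m t = m 0 := PreconnectedSpace.constant inferInstance hc
  have h1 : (m 0 : ℝ) = n := by have := hm 0; linarith
  rw [hm t, h0, h1]

theorem rot_conj (f h : HomeoPlus) : rot (h * f * h⁻¹) = rot f := by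
  obtain ⟨F, hF⟩ := exists_isLift f
  obtain ⟨K, hK⟩ := exists_isLift h
  rw [rot_eq_of_isLift ((hK.mul hF).mul hK.inv), rot_eq_of_isLift hF]
  congr 1
  simp

/-- Homeomorphisms that agree on a nonempty set have lifts that agree over it. -/
theorem exists_isLift_agree {f g : HomeoPlus} {S : Set UnitAddCircle} (hS : S.Nonempty)
    (h : ∀ x ∈ S, f x = g x) {K : CircleDeg1Liftˣ} (hK : IsLift K g) :
    ∃ F, IsLift F f ∧ ∀ t : ℝ, (t : UnitAddCircle) ∈ S → F t = K t := by
  obtain ⟨x, hx⟩ := hS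
  obtain ⟨t₀, rfl⟩ := QuotientAddGroup.mk_surjective x
  obtain ⟨F₀, hF₀⟩ := exists_isLift f
  obtain ⟨n, hn⟩ := coe_eq_coe_iff.1 ((hK t₀).symm.trans ((h _ hx).symm.trans (hF₀ t₀)))
  set F := CircleDeg1Lift.translate (Multiplicative.ofAdd (n : ℝ)) * F₀ with hFdef
  have hF : IsLift F f := isLift_translate_mul hF₀ n
  have h0 : F t₀ = K t₀ := by
    rw [hn, hFdef]
    change CircleDeg1Lift.translate (Multiplicative.ofAdd (n : ℝ)) (F₀ t₀) = _
    rw [CircleDeg1Lift.translate_apply, add_comm]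
  refine ⟨F, hF, fun t ht => ?_⟩
  obtain ⟨m, hm⟩ := coe_eq_coe_iff.1 ((hF t).symm.trans ((h _ ht).trans (hK t)))
  -- Both lifts put `t` in the same half-open unit interval starting at `K t₀ + ⌊t - t₀⌋`, so the
  -- integer by which they differ there is zero.
  have key : ∀ L : CircleDeg1Liftˣ, L t₀ + ⌊t - t₀⌋ ≤ L t ∧ L t < L t₀ + ⌊t - t₀⌋ + 1 := by
    intro L
    have e1 : L (t₀ + ⌊t - t₀⌋) = L t₀ + ⌊t - t₀⌋ := (L : CircleDeg1Lift).map_add_int _ _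
    have e2 : L (t₀ + ⌊t - t₀⌋ + 1) = L (t₀ + ⌊t - t₀⌋) + 1 := (L : CircleDeg1Lift).map_add_one _
    rw [← e1, ← e2]
    exact ⟨(strictMono L).monotone (by linarith [Int.floor_le (t - t₀)]),
      strictMono L (by linarith [Int.lt_floor_add_one (t - t₀)])⟩
  have k1 := key F
  have k2 := key K
  rw [h0] at k1
  have hm1 : (m : ℝ) < 1 := by linarith
  have hm2 : (-1 : ℝ) < m := by linarith
  have : m = 0 := by
    have a : m < 1 := by exact_mod_cast hm1
    have b : -1 < m := by exact_mod_cast hm2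
    omega
  simpa [this] using hm

/-- The translation number can be computed along a single orbit, and lifts that agree over an
invariant set share the orbit of any point over it. -/
theorem rot_eq_of_agree {f g : HomeoPlus} {S : Set UnitAddCircle} (hS : S.Nonempty)
    (h : ∀ x ∈ S, f x = g x) (hg : ∀ x ∈ S, g x ∈ S) : rot f = rot g := by
  obtain ⟨K, hK⟩ := exists_isLift g
  obtain ⟨F, hF, hFK⟩ := exists_isLift_agree hS h hK
  obtain ⟨x, hx⟩ := hS
  obtain ⟨t, rfl⟩ := QuotientAddGroup.mk_surjective x
  rw [rot_eq_of_isLift hF, rot_eq_of_isLift hK]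
  congr 1
  have key : ∀ n : ℕ, ((F : CircleDeg1Lift) ^ n) t = ((K : CircleDeg1Lift) ^ n) t ∧
      ((((K : CircleDeg1Lift) ^ n) t : ℝ) : UnitAddCircle) ∈ S := by
    intro n
    induction n with
    | zero => exact ⟨rfl, hx⟩
    | succ n ih =>
      rw [pow_succ', pow_succ', CircleDeg1Lift.mul_apply, CircleDeg1Lift.mul_apply, ih.1]
      refine ⟨hFK _ ih.2, ?_⟩
      have := hg _ ih.2
      rwa [hK] at this
  have h1 := CircleDeg1Lift.tendsto_translationNumber (F : CircleDeg1Lift) t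
  have h2 := CircleDeg1Lift.tendsto_translationNumber (K : CircleDeg1Lift) t
  refine tendsto_nhds_unique h1 ?_
  simpa only [(key _).1] using h2

theorem uniformDist_lt_iff {f g : HomeoPlus} {ε : ℝ} (hε : 0 < ε) :
    uniformDist f g < ε ↔ ∀ x, dist (f x) (g x) < ε :=
  ContinuousMap.dist_lt_iff hε

theorem dist_coe_le (s t : ℝ) : dist (s : UnitAddCircle) (t : UnitAddCircle) ≤ |s - t| := by
  rw [dist_eq_norm, ← AddCircle.coe_sub]
  exact QuotientAddGroup.norm_mk_le_norm (S := AddSubgroup.zmultiples (1 : ℝ)) (m := s - t)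

theorem exists_coe_mem_Ioo {D : Set UnitAddCircle} (hD : Dense D) {a b : ℝ} (hab : a < b) :
    ∃ t ∈ Set.Ioo a b, (t : UnitAddCircle) ∈ D := by
  have ho : IsOpen ((fun t : ℝ => (t : UnitAddCircle)) '' Set.Ioo a b) :=
    QuotientAddGroup.isOpenMap_coe _ isOpen_Ioo
  obtain ⟨x, hx, t, ht, rfl⟩ := hD.exists_mem_open ho ((Set.nonempty_Ioo.2 hab).image _)
  exact ⟨t, ht, hx⟩

/-- A homeomorphism is determined up to `ε` by its values on a suitable finite subset of a dense
set. -/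
theorem exists_finite_uniformDist_lt {D : Set UnitAddCircle} (hD : Dense D) (g : HomeoPlus)
    {ε : ℝ} (hε : 0 < ε) :
    ∃ S ⊆ D, S.Finite ∧ ∀ f : HomeoPlus, (∀ x ∈ S, f x = g x) → uniformDist f g < ε := by
  obtain ⟨K, hK⟩ := exists_isLift g
  have huc : UniformContinuousOn K (Set.Icc (-1 : ℝ) 2) :=
    isCompact_Icc.uniformContinuousOn_of_continuous (continuous_unit K).continuousOn
  obtain ⟨δ, hδ, hKδ⟩ := Metric.uniformContinuousOn_iff.1 huc ε hε
  -- With one sample point in each interval of length `1 / N`, the two samples enclosing `t` are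
  -- less than `3 / N < δ` apart, and monotonicity squeezes both lifts between their common values
  -- there. The indices `-1` and `N` enclose the ends of `[0, 1)`; `2 < N` keeps all samples in
  -- `[-1, 2]`.
  obtain ⟨N, hN⟩ := exists_nat_gt (max 2 (3 / δ))
  have hN2 : (2 : ℝ) < N := (le_max_left _ _).trans_lt hN
  have hNpos : (0 : ℝ) < N := by linarith
  have hNδ : 3 / (N : ℝ) < δ := by
    rw [div_lt_comm₀ hNpos hδ]; exact (le_max_right _ _).trans_lt hN
  have hd : ∀ i : ℤ, ∃ t ∈ Set.Ioo ((i : ℝ) / N) ((i + 1 : ℝ) / N), (t : UnitAddCircle) ∈ D :=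
    fun i => exists_coe_mem_Ioo hD (by gcongr; linarith)
  choose d hdI hdD using hd
  refine ⟨(fun i : ℤ => (d i : UnitAddCircle)) '' Set.Icc (-1) N, ?_,
    (Set.finite_Icc _ _).image _, fun f hf => ?_⟩
  · rintro _ ⟨i, -, rfl⟩; exact hdD i
  have h0N : (0 : ℤ) ∈ Set.Icc (-1 : ℤ) N := ⟨by simp, by positivity⟩
  obtain ⟨F, hF, hFK⟩ := exists_isLift_agree ((Set.nonempty_of_mem h0N).image _) hf hK
  rw [uniformDist_lt_iff hε]
  intro x
  obtain ⟨t, ht, rfl⟩ := AddCircle.eq_coe_Ico x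
  rw [hF, hK]
  refine (dist_coe_le _ _).trans_lt ?_
  set i : ℤ := ⌊t * N⌋ with hi
  have hi1 : (i : ℝ) ≤ t * N := Int.floor_le _
  have hi2 : t * N < i + 1 := Int.lt_floor_add_one _
  have hi0 : (0 : ℤ) ≤ i := Int.floor_nonneg.2 (mul_nonneg ht.1 hNpos.le)
  have hiN : i < N := by
    have : (i : ℝ) < N := hi1.trans_lt (by nlinarith [ht.2])
    exact_mod_cast this
  have hiN' : (i : ℝ) + 1 ≤ N := by exact_mod_cast hiN
  have hi0' : (0 : ℝ) ≤ i := by exact_mod_cast hi0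
  have hl := hdI (i - 1)
  have hr := hdI (i + 1)
  push_cast at hl hr
  simp only [Set.mem_Ioo, div_lt_iff₀ hNpos, lt_div_iff₀ hNpos] at hl hr
  have l1 : d (i - 1) ≤ t := by nlinarith
  have l2 : t ≤ d (i + 1) := by nlinarith
  have l3 : d (i + 1) - d (i - 1) < δ := by
    refine lt_trans ?_ hNδ
    rw [lt_div_iff₀ hNpos]; nlinarith
  have m1 : d (i - 1) ∈ Set.Icc (-1 : ℝ) 2 := by constructor <;> nlinarith
  have m2 : d (i + 1) ∈ Set.Icc (-1 : ℝ) 2 := by constructor <;> nlinarith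
  have hdist := hKδ _ m2 _ m1 (by rw [Real.dist_eq, abs_of_nonneg (by linarith)]; exact l3)
  rw [Real.dist_eq] at hdist
  have e1 := hFK (d (i - 1)) ⟨i - 1, ⟨by omega, by omega⟩, rfl⟩
  have e2 := hFK (d (i + 1)) ⟨i + 1, ⟨by omega, by omega⟩, rfl⟩
  have a1 := (strictMono F).monotone l1
  have a2 := (strictMono F).monotone l2
  have a3 := (strictMono K).monotone l1
  have a4 := (strictMono K).monotone l2
  have := abs_lt.1 hdist
  rw [abs_lt]
  constructor <;> linarith

theorem sbtw_coe {a b c : ℝ} (hab : a < b) (hbc : b < c) (hca : c < a + 1) :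
    sbtw (a : UnitAddCircle) (b : UnitAddCircle) (c : UnitAddCircle) := by
  rw [sbtw_iff_not_btw, btw_cyclic]
  intro h
  have h2 := (QuotientAddGroup.btw_coe_iff (p := (1 : ℝ))).1 h
  rw [(toIcoMod_eq_self _).2 ⟨(hab.trans hbc).le, hca⟩,
    (toIocMod_eq_self _).2 ⟨hab, (hbc.trans hca).le⟩] at h2
  linarith

theorem circularlyOrdered_coe {n : ℕ} {t : Fin n → ℝ} (ht : StrictMono t)
    (h1 : ∀ i j, t j < t i + 1) : CircularlyOrdered fun i => (t i : UnitAddCircle) := by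
  refine ⟨fun i j hij => ?_, fun i j k hij hjk => sbtw_coe (ht hij) (ht hjk) (h1 i k)⟩
  obtain ⟨m, hm⟩ := coe_eq_coe_iff.1 hij
  have a := h1 i j
  have b := h1 j i
  have h2 : (-1 : ℝ) < m := by linarith
  have h3 : (m : ℝ) < 1 := by linarith
  have h4 : m = 0 := by
    have h2' : -1 < m := by exact_mod_cast h2
    have h3' : m < 1 := by exact_mod_cast h3
    omega
  exact ht.injective (by simpa [h4] using hm)

end HomeoPlus

open HomeoPlus in
/-- A combinatorial group interpolates every orientation-preserving homeomorphism on finite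
subsets of `D₀` with image in `D₀`. -/
theorem IsCombinatorial.exists_agree {D₀ : Set UnitAddCircle} {G₀ : Subgroup HomeoPlus}
    (hG₀ : IsCombinatorial D₀ G₀) (T : HomeoPlus) {Y : Set UnitAddCircle} (hY : Y.Finite)
    (hYD : Y ⊆ D₀) (hTY : ∀ x ∈ Y, T x ∈ D₀) : ∃ g ∈ G₀, ∀ x ∈ Y, g x = T x := by
  classical
  obtain ⟨F, hF⟩ := exists_isLift T
  have hs : ∀ x : UnitAddCircle, ∃ t ∈ Set.Ico (0 : ℝ) 1, (t : UnitAddCircle) = x :=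
    fun x => AddCircle.eq_coe_Ico x
  choose r hr hrx using hs
  set R : Finset ℝ := hY.toFinset.image r with hR
  set t := R.orderEmbOfFin rfl with ht
  have hmem : ∀ i, ∃ x ∈ Y, r x = t i := fun i => by
    have : t i ∈ hY.toFinset.image r := R.orderEmbOfFin_mem rfl i
    simpa using this
  have h01 : ∀ i, t i ∈ Set.Ico (0 : ℝ) 1 := fun i => by
    obtain ⟨x, -, h⟩ := hmem i
    exact h ▸ hr x
  have h1 : ∀ i j, t j < t i + 1 := fun i j => by linarith [(h01 i).1, (h01 j).2]
  have hD : ∀ i, ((t i : ℝ) : UnitAddCircle) ∈ Y := fun i => by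
    obtain ⟨x, hx, h⟩ := hmem i
    rw [← h, hrx]; exact hx
  -- A lift is increasing and commutes with the unit translation, so it maps sorted points within
  -- one period to sorted points within one period.
  obtain ⟨g, hg, hgt⟩ := hG₀.interpolation R.card (fun i => (t i : UnitAddCircle))
    (fun i => ((F (t i) : ℝ) : UnitAddCircle)) (circularlyOrdered_coe t.strictMono h1)
    (circularlyOrdered_coe (t := fun i => F (t i)) ((strictMono F).comp t.strictMono)
      (fun i j => by
        have : F (t i + 1) = F (t i) + 1 := (F : CircleDeg1Lift).map_add_one _
        simp only [← this]
        exact strictMono F (h1 i j))) (fun i => hYD (hD i))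
    (fun i => by rw [← hF]; exact hTY _ (hD i))
  refine ⟨g, hg, fun x hx => ?_⟩
  have : r x ∈ Set.range t := by
    rw [ht, Finset.range_orderEmbOfFin]
    simp only [hR, Finset.coe_image]
    exact ⟨x, by simpa using hx, rfl⟩
  obtain ⟨i, hi⟩ := this
  have := hgt i
  rw [hi, ← hF, hrx] at this
  exact this

/-! ### Finite groups of circle homeomorphisms are groups of rotations -/

namespace HomeoPlus

theorem rot_one : rot 1 = 0 := by
  rw [rot_eq_of_isLift IsLift.one]
  simp

theorem rot_zpow (f : HomeoPlus) (n : ℤ) : rot (f ^ n) = n • rot f := by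
  obtain ⟨F, hF⟩ := exists_isLift f
  have hp : ∀ m : ℕ, IsLift (F ^ m) (f ^ m) := hF.pow
  have h : IsLift (F ^ n) (f ^ n) := by
    obtain ⟨m, rfl | rfl⟩ := n.eq_nat_or_neg
    · simpa using hp m
    · simpa using (hp m).inv
  rw [rot_eq_of_isLift h, rot_eq_of_isLift hF, CircleDeg1Lift.translationNumber_zpow,
    ← AddCircle.coe_zsmul, zsmul_eq_mul]

theorem rot_pow (f : HomeoPlus) (n : ℕ) : rot (f ^ n) = n • rot f := by
  simpa using rot_zpow f n

theorem rot_eq_zero_of_apply_eq {f : HomeoPlus} {x : UnitAddCircle} (h : f x = x) :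
    rot f = 0 := by
  rw [← rot_one]
  exact rot_eq_of_agree (S := {x}) ⟨x, rfl⟩ (by rintro _ rfl; exact h) (by rintro _ rfl; rfl)

/-- A finite group of circle homeomorphisms is conjugate to a group of rotations. -/
theorem exists_linearization {C : Type*} [Group C] [Finite C] (ρ : C →* HomeoPlus) :
    ∃ Ψ : HomeoPlus, ∀ c y, Ψ (ρ c y) = Ψ y + rot (ρ c) := by
  classical
  have := Fintype.ofFinite C
  choose L hL using fun c => exists_isLift (ρ c)
  have hcard : (0 : ℝ) < Fintype.card C := by exact_mod_cast Fintype.card_pos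
  have hlt : ∀ s t : ℝ, s < t → (∑ c, L c s) / Fintype.card C < (∑ c, L c t) / Fintype.card C := by
    intro s t hst
    gcongr 1
    exact Finset.sum_lt_sum_of_nonempty Finset.univ_nonempty fun c _ => strictMono (L c) hst
  -- The average of the lifts. As `L c' ∘ L c` and `L (c' * c)` differ by an integer, precomposition
  -- with `L c` permutes the summands up to integers, hence shifts the average by a constant `θ`.
  let Φ : CircleDeg1Lift :=
    { toFun := fun t => (∑ c, L c t) / Fintype.card C
      monotone' := StrictMono.monotone fun s t => hlt s t
      map_add_one' := fun t => by
        have : ∀ c, L c (t + 1) = L c t + 1 := fun c => (L c : CircleDeg1Lift).map_add_one t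
        simp only [this, Finset.sum_add_distrib]
        field_simp
        simp }
  have hΦ : ∀ t, Φ t = (∑ c, L c t) / Fintype.card C := fun _ => rfl
  have hinj : Function.Injective Φ := StrictMono.injective fun s t => hlt s t
  have hcont : Continuous Φ :=
    (continuous_finsetSum _ fun c _ => continuous_unit (L c)).div_const _
  obtain ⟨U, hU⟩ := CircleDeg1Lift.isUnit_iff_bijective.2
    ⟨hinj, Φ.continuous_iff_surjective.1 hcont⟩
  refine ⟨ofLift U, fun c y => ?_⟩
  obtain ⟨t, rfl⟩ := QuotientAddGroup.mk_surjective y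
  have hn : ∀ c', ∃ n : ℤ, ∀ s, L c' (L c s) = L (c' * c) s + n := fun c' => by
    have h1 := (hL c').mul (hL c)
    rw [← map_mul] at h1
    exact h1.exists_int (hL (c' * c))
  choose n hn using hn
  set θ : ℝ := (∑ c', (n c' : ℝ)) / Fintype.card C with hθ
  have hs : ∀ s, Φ (L c s) = θ + Φ s := fun s => by
    rw [hΦ, hΦ, hθ, ← add_div]
    congr 1
    simp only [hn, Finset.sum_add_distrib]
    rw [add_comm, ← Equiv.sum_comp (Equiv.mulRight c) (fun c' => L c' s)]
    rfl
  have hrot : rot (ρ c) = (θ : UnitAddCircle) := by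
    rw [rot_eq_of_isLift (hL c), CircleDeg1Lift.translationNumber_eq_of_semiconj (f := Φ)
      (g₂ := CircleDeg1Lift.translate (Multiplicative.ofAdd θ)) (fun s => ?_),
      CircleDeg1Lift.translationNumber_translate]
    rw [CircleDeg1Lift.translate_apply]
    exact hs s
  have hUΦ : ∀ s : ℝ, U s = Φ s := fun s => by rw [← hU]
  change ofLift U (ρ c (t : UnitAddCircle)) = ofLift U (t : UnitAddCircle) + _
  rw [hL c t, isLift_ofLift, isLift_ofLift, hrot, ← AddCircle.coe_add, hUΦ, hUΦ, hs, add_comm]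

theorem rot_mul_of_finite {C : Type*} [Group C] [Finite C] (ρ : C →* HomeoPlus) (c d : C) :
    rot (ρ (c * d)) = rot (ρ c) + rot (ρ d) := by
  obtain ⟨Ψ, hΨ⟩ := exists_linearization ρ
  have h := hΨ (c * d) 0
  rw [map_mul, mul_apply, hΨ, hΨ, add_assoc, add_left_cancel_iff] at h
  rw [map_mul, ← h, add_comm]

/-- A homeomorphism of finite order is conjugate to the rotation by its rotation number. -/
theorem eq_one_of_rot_eq_zero {f : HomeoPlus} (hf : IsOfFinOrder f) (h : rot f = 0) : f = 1 := by
  have : Finite (Subgroup.zpowers f) := finite_zpowers.2 hf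
  obtain ⟨Ψ, hΨ⟩ := exists_linearization (Subgroup.zpowers f).subtype
  refine ext_apply fun x => injective Ψ ?_
  have := hΨ ⟨f, Subgroup.mem_zpowers f⟩ x
  simpa [h] using this

theorem addOrderOf_rot {f : HomeoPlus} (hf : IsOfFinOrder f) : addOrderOf (rot f) = orderOf f := by
  refine Nat.dvd_antisymm (addOrderOf_dvd_of_nsmul_eq_zero ?_) (orderOf_dvd_of_pow_eq_one ?_)
  · rw [← rot_pow, pow_orderOf_eq_one, rot_one]
  · exact eq_one_of_rot_eq_zero hf.pow (by rw [rot_pow, addOrderOf_nsmul_eq_zero])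

/-- A finite group acting faithfully on the circle is cyclic. -/
theorem isCyclic_of_injective {C : Type*} [Group C] [Finite C] {ρ : C →* HomeoPlus}
    (hρ : Function.Injective ρ) : IsCyclic C := by
  -- Rotation numbers embed the group in the unit circle of the field `ℂ`, where finite
  -- multiplicative groups are cyclic.
  let χ : C →* ℂ :=
    { toFun := fun c => (AddCircle.toCircle (rot (ρ c)) : ℂ)
      map_one' := by simp [rot_one]
      map_mul' := fun c d => by
        rw [rot_mul_of_finite, AddCircle.toCircle_add, Circle.coe_mul] }
  refine isCyclic_of_injective_ringHom χ ((injective_iff_map_eq_one χ).2 fun c hc => ?_)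
  have h1 : AddCircle.toCircle (rot (ρ c)) = AddCircle.toCircle (0 : UnitAddCircle) := by
    rw [AddCircle.toCircle_zero]; exact Subtype.ext hc
  have h2 := AddCircle.injective_toCircle one_ne_zero h1
  refine (injective_iff_map_eq_one ρ).1 hρ c (eq_one_of_rot_eq_zero ?_ h2)
  exact ρ.isOfFinOrder (isOfFinOrder_of_finite c)

theorem exists_zpow_rot_eq {f : HomeoPlus} {q : ℕ} (hq : 0 < q) (hf : orderOf f = q)
    {θ : UnitAddCircle} (hθ : q • θ = 0) : ∃ j : ℤ, rot (f ^ j) = θ := by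
  have hfin : IsOfFinOrder f := orderOf_pos_iff.1 (hf ▸ hq)
  obtain ⟨m, -, hm, hmf⟩ := (AddCircle.addOrderOf_eq_pos_iff hq).1 ((addOrderOf_rot hfin).trans hf)
  obtain ⟨k, -, rfl⟩ := (AddCircle.nsmul_eq_zero_iff hq).1 hθ
  -- Here `rot f = m / q` with `m` prime to `q`, and `θ = k / q`; the Bézout coefficient inverts `m`
  -- modulo `q`.
  refine ⟨k * m.gcdA q, ?_⟩
  have hb : (1 : ℤ) = m * m.gcdA q + q * m.gcdB q := by rw [← Nat.gcd_eq_gcd_ab, hm]; rfl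
  have hb' : (1 : ℝ) = m * m.gcdA q + q * m.gcdB q := by exact_mod_cast hb
  rw [rot_zpow, ← hmf, ← AddCircle.coe_zsmul, coe_eq_coe_iff]
  refine ⟨-k * m.gcdB q, ?_⟩
  have hq' : (q : ℝ) ≠ 0 := by positivity
  push_cast
  rw [zsmul_eq_mul]
  push_cast
  field_simp
  linear_combination (-(k : ℝ)) * hb'

/-! ### Equivariant perturbations into a dense set -/

/-- An increasing homeomorphism of the line that moves the points over the orbit of `x` under
the rotations of order `q` slightly forward, commuting with these rotations. -/
theorem exists_bump {D : Set UnitAddCircle} (hD : Dense D) {q : ℕ} (hq : 0 < q)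
    (x : UnitAddCircle) {r : ℝ} (hr : 0 < r) :
    ∃ B : CircleDeg1Liftˣ, (∀ t, t ≤ B t) ∧ (∀ t, B t ≤ t + r) ∧
      (∀ t : ℝ, r ≤ ‖q • ((t : UnitAddCircle) - x)‖ → B t = t) ∧
      (∀ t : ℝ, (t : UnitAddCircle) = x → t < B t ∧ ((B t : ℝ) : UnitAddCircle) ∈ D) ∧
      ∀ t θ : ℝ, q • (θ : UnitAddCircle) = 0 → B (t + θ) = B t + θ := by
  obtain ⟨x₀, rfl⟩ := QuotientAddGroup.mk_surjective x
  have hq' : (0 : ℝ) < q := by exact_mod_cast hq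
  obtain ⟨d, ⟨hd1, hd2⟩, hdD⟩ := exists_coe_mem_Ioo hD (a := x₀) (b := x₀ + r / q)
    (by linarith [div_pos hr hq'])
  -- The displacement will be `k * max 0 (r - u t)`, with `u` a `q`-Lipschitz function invariant
  -- under `q`-torsion. This `k` sends the peak `x₀` exactly to `d`, and `d < x₀ + r / q` gives `k *
  -- q < 1`, hence strict monotonicity.
  set k := (d - x₀) / r with hk
  have hkr : k * r = d - x₀ := by rw [hk]; field_simp
  have hk0 : 0 < k := div_pos (by linarith) hr
  have hkq : k * q < 1 := by
    have : d - x₀ < r / q := by linarith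
    rw [lt_div_iff₀ hq'] at this
    rw [hk, div_mul_eq_mul_div, div_lt_one hr]
    exact this
  let u : ℝ → ℝ := fun t => ‖q • ((t : UnitAddCircle) - (x₀ : UnitAddCircle))‖
  have hu : ∀ s t, u s ≤ u t + q * |s - t| := fun s t => by
    have h1 : q • ((s : UnitAddCircle) - (x₀ : UnitAddCircle)) =
        q • ((t : UnitAddCircle) - (x₀ : UnitAddCircle)) + q • ((s - t : ℝ) : UnitAddCircle) := by
      rw [AddCircle.coe_sub, ← smul_add]; congr 1; abel
    have h2 : ‖q • ((s - t : ℝ) : UnitAddCircle)‖ ≤ q * |s - t| := by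
      rw [← AddCircle.coe_nsmul]
      refine (QuotientAddGroup.norm_mk_le_norm (S := AddSubgroup.zmultiples (1 : ℝ))
        (m := q • (s - t))).trans ?_
      rw [nsmul_eq_mul, Real.norm_eq_abs, abs_mul, abs_of_pos hq']
    calc u s = ‖_‖ := by simp only [u]; rw [h1]
      _ ≤ _ := (norm_add_le _ _).trans (by gcongr)
  have huθ : ∀ t θ : ℝ, q • (θ : UnitAddCircle) = 0 → u (t + θ) = u t := fun t θ h => by
    simp only [u]
    rw [AddCircle.coe_add, add_sub_right_comm, smul_add, h, add_zero]
  let F : ℝ → ℝ := fun t => t + k * max 0 (r - u t)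
  have hFθ : ∀ t θ : ℝ, q • (θ : UnitAddCircle) = 0 → F (t + θ) = F t + θ := fun t θ h => by
    simp only [F, huθ t θ h]; ring
  have hmono : StrictMono F := fun s t hst => by
    have h1 := hu t s
    rw [abs_of_pos (sub_pos.2 hst)] at h1
    have h2 : max 0 (r - u s) ≤ max 0 (r - u t) + q * (t - s) := by
      have h3 : 0 ≤ q * (t - s) := mul_nonneg hq'.le (by linarith)
      refine max_le (by linarith [le_max_left 0 (r - u t)]) ?_
      linarith [le_max_right 0 (r - u t)]
    have h3 := mul_le_mul_of_nonneg_left h2 hk0.le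
    simp only [F]
    nlinarith [mul_pos (sub_pos.2 hkq) (sub_pos.2 hst)]
  have hcont : Continuous F := by
    have h1 : Continuous (fun t : ℝ => (t : UnitAddCircle)) := AddCircle.continuous_mk' 1
    simp only [F, u]
    fun_prop
  let Φ : CircleDeg1Lift :=
    { toFun := F
      monotone' := hmono.monotone
      map_add_one' := fun t => hFθ t 1 (by
        have : ((1 : ℝ) : UnitAddCircle) = 0 := AddCircle.coe_period 1
        rw [this, smul_zero]) }
  obtain ⟨B, hB⟩ := CircleDeg1Lift.isUnit_iff_bijective.2
    ⟨(hmono.injective : Function.Injective Φ), Φ.continuous_iff_surjective.1 hcont⟩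
  have hBF : ∀ t, B t = F t := fun t => by rw [hB]; rfl
  have hu0 : ∀ t, 0 ≤ u t := fun t => norm_nonneg _
  refine ⟨B, fun t => ?_, fun t => ?_, fun t ht => ?_, fun t ht => ?_, fun t θ h => ?_⟩
  · rw [hBF]; simp only [F]; nlinarith [le_max_left 0 (r - u t)]
  · rw [hBF]; simp only [F]
    have h1 : max 0 (r - u t) ≤ r := max_le hr.le (by linarith [hu0 t])
    have h2 : k ≤ 1 := by
      have : (1 : ℝ) ≤ q := by exact_mod_cast hq
      nlinarith
    nlinarith
  · rw [hBF]; simp only [F]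
    rw [max_eq_left (sub_nonpos.2 ht)]; ring
  · have hut : u t = 0 := by
      change (t : UnitAddCircle) = (x₀ : UnitAddCircle) at ht
      simp only [u]; rw [ht]; simp
    have : F t = t + (d - x₀) := by
      simp only [F]; rw [hut, sub_zero, max_eq_right hr.le, hkr]
    rw [hBF, this]
    refine ⟨by linarith, ?_⟩
    have : ((t + (d - x₀) : ℝ) : UnitAddCircle) = (d : UnitAddCircle) := by
      change (t : UnitAddCircle) = (x₀ : UnitAddCircle) at ht
      rw [AddCircle.coe_add, AddCircle.coe_sub, ht]; abel
    rwa [this]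
  · rw [hBF, hBF, hFθ t θ h]

theorem exists_pos_le_of_finite {α : Type*} {S : Set α} (hS : S.Finite) (u : α → ℝ)
    (hu : ∀ x ∈ S, 0 < u x) : ∃ r : ℝ, 0 < r ∧ ∀ x ∈ S, r ≤ u x := by
  induction S, hS using Set.Finite.induction_on with
  | empty => exact ⟨1, one_pos, by simp⟩
  | @insert a S _ _ ih =>
    obtain ⟨r, hr, h⟩ := ih fun x hx => hu x (Set.mem_insert_of_mem _ hx)
    refine ⟨min r (u a), lt_min hr (hu a (Set.mem_insert _ _)), ?_⟩
    rintro x (rfl | hx)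
    · exact min_le_right _ _
    · exact (min_le_left _ _).trans (h x hx)

/-- A finite set can be moved into a dense set by a homeomorphism close to the identity that
commutes with the rotations of order `q` and fixes given points of the dense set. -/
theorem exists_move {D : Set UnitAddCircle} (hD : Dense D) {q : ℕ} (hq : 0 < q)
    (hinv : ∀ d ∈ D, ∀ x, q • (x - d) = 0 → x ∈ D) {T : Set UnitAddCircle} (hT : T.Finite)
    (hTD : T ⊆ D) {S : Set UnitAddCircle} (hS : S.Finite) {ε : ℝ} (hε : 0 < ε) :
    ∃ ψ : HomeoPlus, (∀ x ∈ T, ψ x = x) ∧ (∀ x ∈ S, ψ x ∈ D) ∧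
      (∀ x θ, q • θ = 0 → ψ (x + θ) = ψ x + θ) ∧ ∀ x, dist (ψ x) x < ε := by
  induction S, hS using Set.Finite.induction_on generalizing ε with
  | empty => exact ⟨1, fun _ _ => rfl, by simp, fun _ _ _ => rfl, fun x => by simpa [one_apply]⟩
  | @insert a S _ hS ih =>
    obtain ⟨ψ, h1, h2, h3, h4⟩ := ih (half_pos hε)
    by_cases ha : ψ a ∈ D
    · refine ⟨ψ, h1, ?_, h3, fun x => (h4 x).trans (half_lt_self hε)⟩
      rintro x (rfl | hx)
      exacts [ha, h2 x hx]
    -- `D` is stable under `q`-torsion, so the translates of `ψ a ∉ D` miss `T` and `ψ '' S`, which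
    -- lie in `D`; a narrow bump fixes all those points.
    obtain ⟨r, hr, hrle⟩ := exists_pos_le_of_finite (hT.union (hS.image ψ))
      (fun y => ‖q • (y - ψ a)‖) (fun y hy => by
        rw [norm_pos_iff]
        intro h
        refine ha (hinv y ?_ _ ?_)
        · rcases hy with hy | ⟨y, hy, rfl⟩
          exacts [hTD hy, h2 y hy]
        · rw [← neg_sub, smul_neg, h, neg_zero])
    obtain ⟨B, hB1, hB2, hB3, hB4, hB5⟩ := exists_bump hD hq (ψ a)
      (lt_min hr (half_pos (half_pos hε)))
    have hfix : ∀ y ∈ T ∪ ψ '' S, ofLift B y = y := fun y hy => by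
      obtain ⟨t, rfl⟩ := QuotientAddGroup.mk_surjective y
      have := hB3 t ((min_le_left _ _).trans (hrle _ hy))
      exact (isLift_ofLift B t).trans (by rw [this])
    refine ⟨ofLift B * ψ, fun x hx => ?_, ?_, fun x θ h => ?_, fun x => ?_⟩
    · rw [mul_apply, h1 x hx, hfix x (Or.inl hx)]
    · rintro x (rfl | hx)
      · obtain ⟨t, ht⟩ := QuotientAddGroup.mk_surjective (ψ x)
        rw [mul_apply, ← ht]
        rw [isLift_ofLift]
        exact (hB4 t ht).2
      · rw [mul_apply, hfix _ (Or.inr ⟨x, hx, rfl⟩)]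
        exact h2 x hx
    · rw [mul_apply, mul_apply, h3 x θ h]
      obtain ⟨t, ht⟩ := QuotientAddGroup.mk_surjective (ψ x)
      obtain ⟨s, rfl⟩ := QuotientAddGroup.mk_surjective θ
      rw [← ht]
      change ofLift B ((t : UnitAddCircle) + (s : UnitAddCircle)) =
        ofLift B (t : UnitAddCircle) + (s : UnitAddCircle)
      rw [← AddCircle.coe_add, isLift_ofLift, isLift_ofLift, hB5 t s h, AddCircle.coe_add]
    · rw [mul_apply]
      refine (dist_triangle _ (ψ x) _).trans_lt ?_
      have h5 : dist (ofLift B (ψ x)) (ψ x) < ε / 2 := by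
        obtain ⟨t, ht⟩ := QuotientAddGroup.mk_surjective (ψ x)
        rw [← ht]
        rw [isLift_ofLift]
        refine (dist_coe_le _ _).trans_lt ?_
        have a1 := hB1 t
        have a2 := hB2 t
        have a3 := min_le_right r (ε / 2 / 2)
        rw [abs_of_nonneg (by linarith)]
        linarith
      linarith [h4 x]

end HomeoPlus

/-! ### Finite order, conjugacy and infinite order in combinatorial groups -/

namespace IsCombinatorial

open HomeoPlus

variable {D₀ : Set UnitAddCircle} {G₀ : Subgroup HomeoPlus}

theorem apply_mem (hG₀ : IsCombinatorial D₀ G₀) (g : G₀) {x : UnitAddCircle} (hx : x ∈ D₀) :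
    (g : HomeoPlus) x ∈ D₀ :=
  hG₀.invariance g g.2 x hx

theorem dense_image {D : Set UnitAddCircle} (hD : Dense D) (Ψ : HomeoPlus) : Dense (Ψ '' D) :=
  Ψ.1.surjective.denseRange.dense_image (HomeoPlus.continuous Ψ) hD

/-- A finite order homeomorphism can be replaced by an element of a combinatorial group with the
same values on a finite invariant subset of `D₀`. -/
theorem exists_finite_order_agree (hD₀ : Dense D₀) (hG₀ : IsCombinatorial D₀ G₀) {a : HomeoPlus}
    (ha : IsOfFinOrder a) {Z : Set UnitAddCircle} (hZ : Z.Finite)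
    (hZD : Z ⊆ D₀) (hZa : ∀ z ∈ Z, a z ∈ Z) :
    ∃ b : G₀, orderOf (b : HomeoPlus) = orderOf a ∧ rot b = rot a ∧
      ∀ z ∈ Z, (b : HomeoPlus) z = a z := by
  set q := orderOf a with hq
  have hq0 : 0 < q := orderOf_pos_iff.2 ha
  have hqa : q • rot a = 0 := by rw [← rot_pow, hq, pow_orderOf_eq_one, rot_one]
  obtain ⟨c₀, hc₀, hc₀q⟩ := hG₀.order q hq0
  have hfin₀ : IsOfFinOrder c₀ := orderOf_pos_iff.1 (hc₀q ▸ hq0)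
  obtain ⟨j, hj⟩ := exists_zpow_rot_eq hq0 hc₀q hqa
  set c := c₀ ^ j with hc
  have hcG : c ∈ G₀ := G₀.zpow_mem hc₀ j
  have hcfin : IsOfFinOrder c := hfin₀.zpow
  have hcq : orderOf c = q := by
    rw [← addOrderOf_rot hcfin, hj, addOrderOf_rot ha]
  have : Finite (Subgroup.zpowers a) := finite_zpowers.2 ha
  have : Finite (Subgroup.zpowers c) := finite_zpowers.2 hcfin
  obtain ⟨Ψ₁, h₁⟩ := exists_linearization (Subgroup.zpowers a).subtype
  obtain ⟨Ψ₂, h₂⟩ := exists_linearization (Subgroup.zpowers c).subtype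
  -- In linearizing coordinates `a` and `c` are the same rotation, so any `ψ` commuting with
  -- `q`-torsion gives a conjugacy `Ψ₂⁻¹ * ψ * Ψ₁`. The powers of `c` realize all `q`-torsion
  -- rotations and preserve `D₀`, so `Ψ₂ '' D₀` has the invariance required of the dense set.
  obtain ⟨ψ, -, hψ, hψr, -⟩ := exists_move (dense_image hD₀ Ψ₂) hq0 (by
    rintro _ ⟨d, hd, rfl⟩ x hx
    obtain ⟨k, hk⟩ := exists_zpow_rot_eq hq0 hcq hx
    refine ⟨(c ^ k) d, hG₀.invariance _ (G₀.zpow_mem hcG k) d hd, ?_⟩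
    have := h₂ ⟨c ^ k, k, rfl⟩ d
    simp only [Subgroup.subtype_apply] at this
    rw [this, hk]; abel) Set.finite_empty (Set.empty_subset _) (hZ.image Ψ₁) one_pos
  set k : HomeoPlus := Ψ₂⁻¹ * ψ * Ψ₁ with hk
  have hka : ∀ y, k (a y) = c (k y) := fun y => by
    have e1 := h₁ ⟨a, Subgroup.mem_zpowers a⟩ y
    have e2 := h₂ ⟨c, Subgroup.mem_zpowers c⟩ (k y)
    simp only [Subgroup.subtype_apply] at e1 e2
    rw [hj] at e2
    apply injective Ψ₂
    rw [e2, hk]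
    simp only [mul_apply, apply_inv_self]
    rw [e1, hψr _ _ hqa]
  have hkZ : ∀ z ∈ Z, k z ∈ D₀ := fun z hz => by
    obtain ⟨d, hd, hd'⟩ := hψ _ ⟨z, hz, rfl⟩
    have : k z = d := by rw [hk, mul_apply, mul_apply, ← hd', inv_apply_self]
    rwa [this]
  -- It is enough to follow the conjugacy `k` on `Z`: since `a` preserves `Z`, the element `h⁻¹ * c
  -- * h` then has the values of `a` there.
  obtain ⟨h, hh, hhk⟩ := hG₀.exists_agree k hZ hZD hkZ
  refine ⟨⟨h⁻¹ * c * h⁻¹⁻¹, ?_⟩, ?_, ?_, fun z hz => ?_⟩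
  · exact G₀.mul_mem (G₀.mul_mem (G₀.inv_mem hh) hcG) (G₀.inv_mem (G₀.inv_mem hh))
  · rw [← hcq]
    exact (MulAut.conj h⁻¹).orderOf_eq c
  · rw [← hj]; exact rot_conj c h⁻¹
  · change (h⁻¹ * c * h⁻¹⁻¹ : HomeoPlus) z = a z
    rw [inv_inv]
    simp only [mul_apply]
    rw [hhk z hz, ← hka, ← hhk _ (hZa z hz), inv_apply_self]

/-- Interpolation of a homeomorphism by an element of a combinatorial group conjugating two given
actions of a finite cyclic group. -/
theorem exists_conj_agree (hG₀ : IsCombinatorial D₀ G₀) {A : Type*} [Group A] [Finite A]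
    [IsCyclic A] (σ₁ σ₂ : A →* G₀) (hrot : ∀ a, rot (σ₁ a) = rot (σ₂ a)) (T : HomeoPlus)
    {E : Set UnitAddCircle} (hE : E.Finite)
    (h : ∀ a, ∀ x ∈ E, (σ₁ a : HomeoPlus) x ∈ D₀ ∧ T ((σ₁ a : HomeoPlus) x) ∈ D₀ ∧
      T ((σ₁ a : HomeoPlus) x) = (σ₂ a : HomeoPlus) (T x)) :
    ∃ η : G₀, (∀ x ∈ E, (η : HomeoPlus) x = T x) ∧ ∀ a, η * σ₁ a * η⁻¹ = σ₂ a := by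
  obtain ⟨α, hα⟩ := IsCyclic.exists_generator (α := A)
  have hfin : ∀ σ : A →* G₀, IsOfFinOrder (σ α : HomeoPlus) := fun σ =>
    (G₀.subtype.comp σ).isOfFinOrder (isOfFinOrder_of_finite α)
  -- `g` follows `T` on the whole `σ₁`-orbit of `E`, so all powers of `g * σ₁ α * g⁻¹` and `σ₂ α`
  -- agree on `T '' E`. The conjugation axiom then gives a correction fixing `T '' E`.
  obtain ⟨g, hg, hgT⟩ := hG₀.exists_agree T
    (Y := ⋃ a : A, (fun x => (σ₁ a : HomeoPlus) x) '' E)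
    (Set.finite_iUnion fun a => hE.image _)
    (Set.iUnion_subset fun a => by rintro _ ⟨x, hx, rfl⟩; exact (h a x hx).1)
    (fun y hy => by
      obtain ⟨a, x, hx, rfl⟩ := Set.mem_iUnion.1 hy
      exact (h a x hx).2.1)
  have hgT' : ∀ a, ∀ x ∈ E, g ((σ₁ a : HomeoPlus) x) = T ((σ₁ a : HomeoPlus) x) :=
    fun a x hx => hgT _ (Set.mem_iUnion.2 ⟨a, x, hx, rfl⟩)
  have hgE : ∀ x ∈ E, g x = T x := fun x hx => by simpa [one_apply] using hgT' 1 x hx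
  have hpow : ∀ n : ℕ, ∀ x ∈ E, ((g * σ₁ α * g⁻¹) ^ n : HomeoPlus) (T x) =
      ((σ₂ α : HomeoPlus) ^ n) (T x) := fun n x hx => by
    have e1 : ((σ₁ α : HomeoPlus) ^ n) = σ₁ (α ^ n) := by simp
    have e2 : ((σ₂ α : HomeoPlus) ^ n) = σ₂ (α ^ n) := by simp
    rw [conj_pow, e1, e2, mul_apply, mul_apply, ← hgE x hx, inv_apply_self, hgT' _ x hx,
      (h _ x hx).2.2, hgE x hx]
  have ho : orderOf (g * σ₁ α * g⁻¹ : HomeoPlus) = orderOf (σ₂ α : HomeoPlus) := by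
    rw [← addOrderOf_rot (hfin σ₂), ← hrot, addOrderOf_rot (hfin σ₁)]
    exact (MulAut.conj g).orderOf_eq _
  obtain ⟨k, hk, hconj, hkE⟩ := hG₀.conjugation _ (orderOf_pos_iff.2 (hfin σ₂))
    (g * σ₁ α * g⁻¹) (G₀.mul_mem (G₀.mul_mem hg (σ₁ α).2) (G₀.inv_mem hg)) (σ₂ α) (σ₂ α).2 ho rfl
    ((rot_conj _ _).trans (hrot α)) (T '' E) (hE.image _)
    (by
      rintro _ ⟨x, hx, rfl⟩
      simpa [one_apply] using (h 1 x hx).2.1)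
    (by
      rintro n - - _ ⟨x, hx, rfl⟩
      exact hpow n x hx)
  refine ⟨⟨k * g, G₀.mul_mem hk hg⟩, fun x hx => ?_, fun a => ?_⟩
  · change k (g x) = T x
    rw [hgE x hx, hkE _ ⟨x, hx, rfl⟩]
  · set η : G₀ := ⟨k * g, G₀.mul_mem hk hg⟩ with hη
    have hηα : η * σ₁ α * η⁻¹ = σ₂ α := Subtype.ext (by
      change (k * g) * (σ₁ α : HomeoPlus) * (k * g)⁻¹ = σ₂ α
      rw [hconj]; group)
    obtain ⟨n, rfl⟩ := Subgroup.mem_zpowers_iff.1 (hα a)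
    rw [map_zpow, map_zpow, ← hηα, conj_zpow]

theorem exists_mem_notMem_of_finite {D : Set UnitAddCircle} (hD : Dense D) {B : Set UnitAddCircle}
    (hB : B.Finite) : ∃ y ∈ D, y ∉ B := by
  have : Infinite (Set.Ico (0 : ℝ) (0 + 1)) := (Set.Ico_infinite (by simp)).to_subtype
  have : Infinite UnitAddCircle := Infinite.of_injective _ (AddCircle.equivIco 1 (0 : ℝ)).symm.injective
  obtain ⟨y, hy, hyD⟩ := hD.exists_mem_open hB.isClosed.isOpen_compl hB.infinite_compl.nonempty
  exact ⟨y, hy, hyD⟩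

/-- If `f` has finite order and `ξ` fixes the orbit of `x`, and moves the orbit of `y` weakly and
the point `y` strictly forward, then `f * ξ` has infinite order. -/
theorem orderOf_mul_eq_zero {f ξ : HomeoPlus} (hf : IsOfFinOrder f) {Z : CircleDeg1Liftˣ}
    (hZ : IsLift Z ξ) {s t : ℝ}
    (hs : ∀ (k : ℕ) (u : ℝ), (u : UnitAddCircle) = (f ^ k) s → Z u = u)
    (ht : ∀ (k : ℕ) (u : ℝ), (u : UnitAddCircle) = (f ^ k) t → u ≤ Z u)
    (ht' : t < Z t) : orderOf (f * ξ) = 0 := by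
  by_contra hne
  have hfin : IsOfFinOrder (f * ξ) := orderOf_pos_iff.1 (Nat.pos_of_ne_zero hne)
  obtain ⟨F, hF⟩ := exists_isLift f
  set N := orderOf f with hN
  have hN0 : 0 < N := orderOf_pos_iff.2 hf
  have hK := hF.mul hZ
  have hFk : ∀ (k : ℕ) (v : ℝ), (((F ^ k : CircleDeg1Liftˣ) v : ℝ) : UnitAddCircle) = (f ^ k) v :=
    fun k v => (hF.pow k v).symm
  have hsucc : ∀ (L : CircleDeg1Liftˣ) (k : ℕ) (v : ℝ),
      (L ^ (k + 1) : CircleDeg1Liftˣ) v = L ((L ^ k : CircleDeg1Liftˣ) v) := fun L k v => by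
    rw [pow_succ']; rfl
  have hmul : ∀ v, (F * Z : CircleDeg1Liftˣ) v = F (Z v) := fun _ => rfl
  have hGs : ∀ k : ℕ, ((F * Z) ^ k : CircleDeg1Liftˣ) s = (F ^ k : CircleDeg1Liftˣ) s := by
    intro k
    induction k with
    | zero => rfl
    | succ k ih => rw [hsucc, hsucc, ih, hmul, hs k _ (hFk k s)]
  have hGt : ∀ k : ℕ, (F ^ (k + 1) : CircleDeg1Liftˣ) t < ((F * Z) ^ (k + 1) : CircleDeg1Liftˣ) t := by
    intro k
    induction k with
    | zero => simpa [hmul] using strictMono F ht'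
    | succ k ih =>
      rw [hsucc F, hsucc (F * Z), hmul]
      refine strictMono F ((ht (k + 1) _ (hFk (k + 1) t)).trans_lt (strictMono Z ih))
  obtain ⟨n, hn⟩ := (hF.pow N).exists_int (K := 1) (by rw [hN, pow_orderOf_eq_one]; exact IsLift.one)
  -- Over the orbit of `s` the lifts `F * Z` and `F` coincide, so `(f * ξ) ^ N` fixes `s` and,
  -- having finite order, is trivial. Its lift is then a translation, equal to that of `F ^ N` at
  -- `s` but strictly larger at `t`.
  have hone : (f * ξ) ^ N = 1 := by
    refine eq_one_of_rot_eq_zero hfin.pow (rot_eq_zero_of_apply_eq (x := (s : UnitAddCircle)) ?_)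
    rw [hK.pow N, hGs, hFk, hN, pow_orderOf_eq_one, one_apply]
  obtain ⟨m, hm⟩ := (hK.pow N).exists_int (K := 1) (by rw [hone]; exact IsLift.one)
  have e1 := hn s
  have e2 := hm s
  rw [hGs, e1] at e2
  have e3 := hGt (N - 1)
  rw [Nat.sub_add_cancel hN0, hn t, hm t] at e3
  linarith [show (1 : CircleDeg1Liftˣ) s = s from rfl]

/-- A finite order element of a combinatorial group can be multiplied by an element of the
centralizer of a finite cyclic subgroup so as to have, stably, infinite order. -/
theorem exists_commute_orderOf_eq_zero (hD₀ : Dense D₀) (hG₀ : IsCombinatorial D₀ G₀)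
    {A : Type*} [Group A] [Finite A] [IsCyclic A] {σ : A →* G₀} (hσ : Function.Injective σ)
    {f : G₀} (hf : IsOfFinOrder (f : HomeoPlus)) {Y : Set UnitAddCircle} (hY : Y.Finite)
    (hYD : Y ⊆ D₀) :
    ∃ ζ : G₀, (∀ a, Commute ζ (σ a)) ∧ (∀ y ∈ Y, (ζ : HomeoPlus) y = y) ∧
      ∃ W ⊆ D₀, W.Finite ∧ Y ⊆ W ∧ ∀ ζ' : G₀, (∀ w ∈ W, (ζ' : HomeoPlus) w = w) →
        orderOf (f * ζ * ζ' : HomeoPlus) = 0 := by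
  set q := Nat.card A with hq
  have hq0 : 0 < q := Nat.card_pos
  obtain ⟨Ψ, hΨ⟩ := exists_linearization (G₀.subtype.comp σ)
  simp only [MonoidHom.comp_apply, Subgroup.subtype_apply] at hΨ
  have hrot : ∀ a, q • rot (σ a) = 0 := fun a => by
    rw [← rot_pow, ← Subgroup.coe_pow, ← map_pow, pow_card_eq_one', map_one, Subgroup.coe_one,
      rot_one]
  have htors : ∀ θ : UnitAddCircle, q • θ = 0 → ∃ a, rot (σ a) = θ := fun θ hθ => by
    obtain ⟨α, hα⟩ := IsCyclic.exists_generator (α := A)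
    have hα' : orderOf (σ α : HomeoPlus) = q := by
      rw [Subgroup.orderOf_coe, orderOf_injective σ hσ, orderOf_eq_card_of_forall_mem_zpowers hα]
    obtain ⟨j, hj⟩ := exists_zpow_rot_eq hq0 hα' hθ
    exact ⟨α ^ j, by rw [map_zpow, Subgroup.coe_zpow, hj]⟩
  have horb : ∀ x : UnitAddCircle, {y | ∃ k : ℕ, y = ((f : HomeoPlus) ^ k) x}.Finite := fun x => by
    refine ((Set.finite_lt_nat (orderOf (f : HomeoPlus))).image
      fun k => ((f : HomeoPlus) ^ k) x).subset ?_
    rintro _ ⟨k, rfl⟩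
    exact ⟨k % orderOf (f : HomeoPlus), Nat.mod_lt _ (orderOf_pos_iff.2 hf), by
      simp only [pow_mod_orderOf]⟩
  have horbD : ∀ x ∈ D₀, {y | ∃ k : ℕ, y = ((f : HomeoPlus) ^ k) x} ⊆ D₀ := by
    rintro x hx _ ⟨k, rfl⟩
    exact hG₀.apply_mem (f ^ k) hx
  obtain ⟨x, hx⟩ := hD₀.nonempty
  set X := {y | ∃ k : ℕ, y = ((f : HomeoPlus) ^ k) x} with hX
  -- In the coordinate `Ψ`, `σ` acts by the `q`-torsion rotations. Choosing `y` off the `σ`-orbits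
  -- of `Y` and `X` allows a `σ`-equivariant bump at `y` to fix both sets.
  obtain ⟨y, hyD, hy⟩ := exists_mem_notMem_of_finite hD₀
    (B := ⋃ z ∈ Y ∪ X, {y | q • (Ψ z - Ψ y) = 0})
    ((hY.union (horb x)).biUnion fun z _ => by
      refine ((AddCircle.finite_torsion (1 : ℝ) hq0).preimage
        (f := fun y => Ψ z - Ψ y) ?_)
      intro u _ v _ h
      exact injective Ψ (sub_right_injective h))
  simp only [Set.mem_iUnion, Set.mem_ofPred_eq, not_exists] at hy
  set O := {z | ∃ k : ℕ, z = ((f : HomeoPlus) ^ k) y} with hO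
  set W := Y ∪ X ∪ O with hW
  have hWfin : W.Finite := (hY.union (horb x)).union (horb y)
  have hWD : W ⊆ D₀ := Set.union_subset (Set.union_subset hYD (horbD x hx)) (horbD y hyD)
  -- With this radius, the only points of `W` that the bump moves are those in the `σ`-orbit of `y`.
  obtain ⟨r, hr, hrle⟩ := exists_pos_le_of_finite
    (hWfin.subset (Set.sep_subset W fun z => q • (Ψ z - Ψ y) ≠ 0))
    (fun z => ‖q • (Ψ z - Ψ y)‖) fun z hz => norm_pos_iff.2 hz.2
  obtain ⟨B, hB1, -, hB3, hB4, hB5⟩ := exists_bump (dense_image hD₀ Ψ) hq0 (Ψ y) hr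
  obtain ⟨U, hU⟩ := exists_isLift Ψ
  set T : HomeoPlus := Ψ⁻¹ * ofLift B * Ψ with hT
  have hTl : IsLift (U⁻¹ * B * U) T := (hU.inv.mul (isLift_ofLift B)).mul hU
  have hTσ : ∀ a u, T ((σ a : HomeoPlus) u) = (σ a : HomeoPlus) (T u) := fun a u => by
    apply injective Ψ
    rw [hΨ, hT]
    simp only [mul_apply, apply_inv_self]
    rw [hΨ]
    obtain ⟨t, ht⟩ := QuotientAddGroup.mk_surjective (Ψ u)
    obtain ⟨θ, hθ⟩ := QuotientAddGroup.mk_surjective (rot (σ a))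
    have h0 := hrot a
    rw [← hθ] at h0
    rw [← ht, ← hθ]
    change ofLift B ((t : UnitAddCircle) + (θ : UnitAddCircle)) =
      ofLift B (t : UnitAddCircle) + (θ : UnitAddCircle)
    rw [← AddCircle.coe_add, isLift_ofLift, isLift_ofLift, hB5 t θ h0, AddCircle.coe_add]
  have hTfix : ∀ z ∈ W, q • (Ψ z - Ψ y) ≠ 0 → ∀ u : ℝ, (u : UnitAddCircle) = z →
      (U⁻¹ * B * U : CircleDeg1Liftˣ) u = u := fun z hz hne u hu => by
    have h1 := hB3 (U u) (by rw [← hU u, hu]; exact hrle z ⟨hz, hne⟩)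
    change U⁻¹ (B (U u)) = u
    rw [h1, CircleDeg1Lift.units_inv_apply_apply]
  have hTfix' : ∀ z ∈ W, q • (Ψ z - Ψ y) ≠ 0 → T z = z := fun z hz hne => by
    obtain ⟨u, rfl⟩ := QuotientAddGroup.mk_surjective z
    exact (hTl u).trans (by rw [hTfix _ hz hne u rfl])
  have hTy : T y ∈ D₀ := by
    obtain ⟨u, hu⟩ := QuotientAddGroup.mk_surjective (Ψ y)
    obtain ⟨d, hd, hd'⟩ := (hB4 u hu).2
    have : T y = d := by
      rw [hT, mul_apply, mul_apply, ← hu, inv_apply_eq, hd']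
      exact isLift_ofLift B u
    rwa [this]
  have hTW : ∀ z ∈ W, T z ∈ D₀ := fun z hz => by
    by_cases hne : q • (Ψ z - Ψ y) = 0
    · obtain ⟨a, ha⟩ := htors _ hne
      have : z = (σ a : HomeoPlus) y := injective Ψ (by rw [hΨ, ha]; abel)
      rw [this, hTσ]
      exact hG₀.apply_mem _ hTy
    · rw [hTfix' z hz hne]; exact hWD hz
  obtain ⟨ζ, hζT, hζσ⟩ := hG₀.exists_conj_agree σ σ (fun _ => rfl) T hWfin fun a z hz =>
    ⟨hG₀.apply_mem _ (hWD hz), by rw [hTσ]; exact hG₀.apply_mem _ (hTW z hz), hTσ a z⟩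
  refine ⟨ζ, fun a => mul_inv_eq_iff_eq_mul.1 (hζσ a), fun z hz => ?_,
    W, hWD, hWfin, fun z hz => Or.inl (Or.inl hz), fun ζ' hζ' => ?_⟩
  · have hzW : z ∈ W := Or.inl (Or.inl hz)
    rw [hζT z hzW, hTfix' z hzW (hy z (Or.inl hz))]
  -- Only the values on `W` enter the infinite-order argument, so later factors fixing `W` cannot
  -- spoil it.
  · have hagree : ∀ z ∈ W, (ζ * ζ' : HomeoPlus) z = T z := fun z hz => by
      rw [mul_apply, hζ' z hz, hζT z hz]
    have hyW : y ∈ W := Or.inr ⟨0, rfl⟩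
    obtain ⟨Z, hZ, hZT⟩ := exists_isLift_agree ⟨y, hyW⟩ hagree hTl
    obtain ⟨s, rfl⟩ := QuotientAddGroup.mk_surjective x
    obtain ⟨t, rfl⟩ := QuotientAddGroup.mk_surjective y
    have hle : ∀ u, u ≤ (U⁻¹ * B * U : CircleDeg1Liftˣ) u := fun u => by
      have := (strictMono U⁻¹).monotone (hB1 (U u))
      rwa [CircleDeg1Lift.units_inv_apply_apply] at this
    rw [mul_assoc]
    refine orderOf_mul_eq_zero hf hZ (s := s) (t := t) (fun k u hu => ?_) (fun k u hu => ?_) ?_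
    · have hu' : (u : UnitAddCircle) ∈ X := ⟨k, hu⟩
      rw [hZT u (Or.inl (Or.inr hu'))]
      exact hTfix _ (Or.inl (Or.inr hu')) (hy _ (Or.inr hu')) u rfl
    · rw [hZT u (Or.inr ⟨k, hu⟩)]
      exact hle u
    · rw [hZT t hyW]
      have := strictMono U⁻¹ (hB4 (U t) (hU t).symm).1
      rwa [CircleDeg1Lift.units_inv_apply_apply] at this

/-- Finitely many elements of a combinatorial group can be given infinite order by multiplying
them with an element of the centralizer of a finite cyclic subgroup. -/
theorem exists_commute_forall_orderOf_eq_zero (hD₀ : Dense D₀) (hG₀ : IsCombinatorial D₀ G₀)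
    {A : Type*} [Group A] [Finite A] [IsCyclic A] {σ : A →* G₀} (hσ : Function.Injective σ)
    {L : Set G₀} (hL : L.Finite) {Y : Set UnitAddCircle} (hY : Y.Finite) (hYD : Y ⊆ D₀) (η : G₀) :
    ∃ ζ : G₀, (∀ a, Commute ζ (σ a)) ∧ (∀ y ∈ Y, (ζ : HomeoPlus) y = y) ∧
      ∀ u ∈ L, orderOf (u * η * ζ) = 0 := by
  induction L, hL using Set.Finite.induction_on generalizing Y η with
  | empty => exact ⟨1, fun _ => Commute.one_left _, fun _ _ => rfl, by simp⟩
  | @insert u L _ _ ih =>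
    obtain ⟨ζ, h1, h2, h3⟩ := ih hY hYD η
    by_cases hu : orderOf (u * η * ζ) = 0
    · refine ⟨ζ, h1, h2, ?_⟩
      rintro v (rfl | hv)
      exacts [hu, h3 v hv]
    have hfin : IsOfFinOrder ((u * η * ζ : G₀) : HomeoPlus) :=
      orderOf_pos_iff.1 (by rw [Subgroup.orderOf_coe]; exact Nat.pos_of_ne_zero hu)
    obtain ⟨ζ₁, k1, k2, W, hWD, hW, hYW, k3⟩ :=
      exists_commute_orderOf_eq_zero hD₀ hG₀ hσ hfin hY hYD
    -- `ζ₂` fixes `W`, which protects the infinite order just obtained for `u`, while it repairs the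
    -- elements of `L` for the new product.
    obtain ⟨ζ₂, m1, m2, m3⟩ := ih hW hWD (η * ζ * ζ₁)
    refine ⟨ζ * ζ₁ * ζ₂, fun a => ((h1 a).mul_left (k1 a)).mul_left (m1 a), fun y hy => ?_, ?_⟩
    · change (ζ : HomeoPlus) ((ζ₁ : HomeoPlus) ((ζ₂ : HomeoPlus) y)) = y
      rw [m2 y (hYW hy), k2 y hy, h2 y hy]
    · rintro v (rfl | hv)
      · have := k3 ζ₂ m2
        rw [← Subgroup.orderOf_coe]
        convert this using 2
        push_cast
        group
      · convert m3 v hv using 2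
        group

end IsCombinatorial

/-! ### Recursion on rooted trees -/

namespace SimpleGraph.IsTree

/-- Geodesics to `w` through either neighbour are paths, and a tree has only one path from `r` to
`w`. -/
theorem eq_of_adj_of_dist {V : Type*} {X : SimpleGraph V} (hX : X.IsTree) {r v v' w : V}
    (h : X.Adj v w) (hd : X.dist r w = X.dist r v + 1) (h' : X.Adj v' w)
    (hd' : X.dist r w = X.dist r v' + 1) : v = v' := by
  obtain ⟨p, hp⟩ := hX.connected.exists_walk_length_eq_dist r v
  obtain ⟨p', hp'⟩ := hX.connected.exists_walk_length_eq_dist r v'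
  have h1 : (p.concat h).IsPath :=
    Walk.isPath_of_length_eq_dist _ (by rw [Walk.length_concat, hp, hd])
  have h2 : (p'.concat h').IsPath :=
    Walk.isPath_of_length_eq_dist _ (by rw [Walk.length_concat, hp', hd'])
  have h3 := (hX.existsUnique_path r w).unique h1 h2
  rw [← Walk.penultimate_concat p h, ← Walk.penultimate_concat p' h', h3]

/-- Recursion on a rooted tree. -/
theorem exists_labelling {V : Type*} {X : SimpleGraph V} (hX : X.IsTree) (r : V) {α : Type*}
    {P : V → α → Prop} {R : V → V → α → α → Prop} (a₀ : α) (h₀ : P r a₀)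
    (hstep : ∀ v w a, X.Adj v w → X.dist r w = X.dist r v + 1 → P v a → ∃ b, P w b ∧ R v w a b) :
    ∃ f : V → α, (∀ v, P v (f v)) ∧
      ∀ v w, X.Adj v w → X.dist r w = X.dist r v + 1 → R v w (f v) (f w) := by
  classical
  have hs : ∀ v w a, ∃ b, X.Adj v w → X.dist r w = X.dist r v + 1 → P v a →
      P w b ∧ R v w a b := fun v w a => by
    by_cases h : X.Adj v w ∧ X.dist r w = X.dist r v + 1 ∧ P v a
    · obtain ⟨b, hb⟩ := hstep v w a h.1 h.2.1 h.2.2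
      exact ⟨b, fun _ _ _ => hb⟩
    · exact ⟨a₀, fun h1 h2 h3 => (h ⟨h1, h2, h3⟩).elim⟩
  choose step hs using hs
  have hp : ∀ w, ∃ v, X.dist r w ≠ 0 → X.Adj v w ∧ X.dist r w = X.dist r v + 1 := fun w => by
    by_cases h : X.dist r w = 0
    · exact ⟨w, fun h' => (h' h).elim⟩
    obtain ⟨p, hp⟩ := hX.connected.exists_walk_length_eq_dist w r
    rw [dist_comm] at h
    cases p with
    | nil => exact (h hp.symm).elim
    | @cons _ v _ hv p =>
      refine ⟨v, fun _ => ⟨hv.symm, ?_⟩⟩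
      have h1 := dist_le p
      have h2 := hX.dist_eq_dist_add_one_of_adj r hv
      rw [Walk.length_cons] at hp
      rw [dist_comm] at h1 hp
      omega
  choose par hp using hp
  -- Recursion on the distance: `g n w` is meaningful only for `n = X.dist r w`.
  let g : ℕ → V → α := fun n => n.rec (fun _ => a₀) fun _ k w => step (par w) w (k (par w))
  have hg : ∀ n w, X.dist r w = n → P w (g n w) := by
    intro n
    induction n with
    | zero =>
      intro w hw
      rw [← (hX.connected r w).dist_eq_zero_iff.1 hw]
      exact h₀
    | succ n ih =>
      intro w hw
      obtain ⟨h1, h2⟩ := hp w (by omega)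
      exact (hs (par w) w (g n (par w)) h1 h2 (ih _ (by omega))).1
  refine ⟨fun w => g (X.dist r w) w, fun v => hg _ v rfl, fun v w h hd => ?_⟩
  obtain ⟨h1, h2⟩ := hp w (by omega)
  have hv : par w = v := hX.eq_of_adj_of_dist h1 h2 h hd
  have : g (X.dist r w) w = step v w (g (X.dist r v) v) := by
    rw [hd, ← hv]
  simp only [this]
  exact (hs v w _ h hd (hg _ v rfl)).2

end SimpleGraph.IsTree

/-! ### Edges and reversals in the fundamental domain -/

namespace Marking

variable {G : Type*} [Group G] {V : Type*} (M : Marking G V)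

theorem action_mul (g h : G) (x : V) : M.action (g * h) x = M.action g (M.action h x) := by
  rw [map_mul]; rfl

theorem action_one (x : V) : M.action 1 x = x := by
  rw [map_one]; rfl

theorem action_inv_eq_iff {g : G} {x y : V} : M.action g⁻¹ x = y ↔ x = M.action g y := by
  constructor
  · rintro rfl; rw [← action_mul, mul_inv_cancel, action_one]
  · rintro rfl; rw [← action_mul, inv_mul_cancel, action_one]

theorem adj_action (g : G) {x y : V} :
    M.tree.Adj (M.action g x) (M.action g y) ↔ M.tree.Adj x y :=
  (M.action g).map_rel_iff

theorem mem_vertexGroup {v : V} {g : G} : g ∈ M.vertexGroup v ↔ M.action g v = v := Iff.rfl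

theorem inv_mul_mem_vertexGroup {v : V} {g h : G} (hgh : M.action g v = M.action h v) :
    g⁻¹ * h ∈ M.vertexGroup v := by
  rw [mem_vertexGroup, action_mul, action_inv_eq_iff, hgh]

variable {M}

theorem vert_eq {v w : V} (hv : v ∈ M.verts) (hw : w ∈ M.verts) {g h : G}
    (hg : M.action g v = M.action h w) : v = w :=
  (M.verts_transversal (M.action h w)).unique ⟨hv, g, hg⟩ ⟨hw, h, rfl⟩

theorem edge_eq {e f : V × V} (he : e ∈ M.edges) (hf : f ∈ M.edges) {g h : G}
    (h1 : M.action g e.1 = M.action h f.1) (h2 : M.action g e.2 = M.action h f.2) : e = f :=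
  (M.edges_transversal (M.action h f.1) (M.action h f.2)
    ((M.adj_action h).2 (M.edges_adj f hf))).unique ⟨he, g, h1, h2⟩ ⟨hf, h, rfl, rfl⟩

variable (M) in
/-- The element `t` maps the reverse of the edge `e'` of the fundamental domain to the edge `e` of
the fundamental domain. -/
structure IsReverse (e e' : V × V) (t : G) : Prop where
  mem : e ∈ M.edges
  mem' : e' ∈ M.edges
  snd : M.action t e'.2 = e.1
  fst : M.action t e'.1 = e.2

theorem mem_stableLetters {e : V × V} (he : e ∈ M.edges) {t : G} :
    t ∈ M.stableLetters e ↔ ∃ e', M.IsReverse e e' t :=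
  ⟨fun ⟨e', h, h1, h2⟩ => ⟨e', he, h, h1, h2⟩, fun ⟨e', h⟩ => ⟨e', h.mem', h.snd, h.fst⟩⟩

theorem exists_isReverse {e : V × V} (he : e ∈ M.edges) : ∃ e' t, M.IsReverse e e' t := by
  obtain ⟨e', ⟨h, t, h1, h2⟩, -⟩ := M.edges_transversal e.2 e.1 (M.edges_adj e he).symm
  exact ⟨e', t, he, h, h2, h1⟩

namespace IsReverse

variable {e e' e'' : V × V} {s t : G}

theorem symm (h : M.IsReverse e e' t) : M.IsReverse e' e t⁻¹ :=
  ⟨h.mem', h.mem, M.action_inv_eq_iff.2 h.fst.symm, M.action_inv_eq_iff.2 h.snd.symm⟩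

theorem unique (h : M.IsReverse e e' t) (h' : M.IsReverse e e'' s) : e' = e'' :=
  edge_eq h.mem' h'.mem' (h.fst.trans h'.fst.symm) (h.snd.trans h'.snd.symm)

theorem ne (h : M.IsReverse e e' t) : e ≠ e' := by
  rintro rfl
  exact M.no_inversion t e.1 e.2 (M.edges_adj e h.mem) ⟨h.fst, h.snd⟩

theorem mul_left (h : M.IsReverse e e' t) {a : G} (h1 : M.action a e.1 = e.1)
    (h2 : M.action a e.2 = e.2) : M.IsReverse e e' (a * t) :=
  ⟨h.mem, h.mem', by rw [action_mul, h.snd, h1], by rw [action_mul, h.fst, h2]⟩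

theorem mul_right (h : M.IsReverse e e' t) {b : G} (h1 : M.action b e'.1 = e'.1)
    (h2 : M.action b e'.2 = e'.2) : M.IsReverse e e' (t * b) :=
  ⟨h.mem, h.mem', by rw [action_mul, h2, h.snd], by rw [action_mul, h1, h.fst]⟩

theorem mul_inv_fst (h : M.IsReverse e e' t) (h' : M.IsReverse e e' s) :
    M.action (s * t⁻¹) e.1 = e.1 := by
  rw [action_mul, M.action_inv_eq_iff.2 h.snd.symm, h'.snd]

theorem mul_inv_snd (h : M.IsReverse e e' t) (h' : M.IsReverse e e' s) :
    M.action (s * t⁻¹) e.2 = e.2 := by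
  rw [action_mul, M.action_inv_eq_iff.2 h.fst.symm, h'.fst]

/-- The reverse of an edge leaving the subtree leaves the subtree. -/
theorem snd_notMem (h : M.IsReverse e e' t) (he : e.2 ∉ M.verts) : e'.2 ∉ M.verts := by
  intro h'
  have h1 := M.edges_origin e h.mem
  have h2 := M.edges_origin e' h.mem'
  have h3 : e'.2 = e.1 := vert_eq h' h1 (g := t) (h := 1) (by rw [h.snd, action_one])
  have h4 : (e'.2, e'.1) ∈ M.edges :=
    M.edges_subtree _ h' _ h2 (M.edges_adj e' h.mem').symm
  have h5 : (e'.2, e'.1) = e :=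
    edge_eq h4 h.mem (g := t) (h := 1) (by simp [h.snd]) (by simp [h.fst])
  exact he (by rw [← h5]; exact h2)

end IsReverse

theorem isReverse_one {v w : V} (hv : v ∈ M.verts) (hw : w ∈ M.verts) (h : M.tree.Adj v w) :
    M.IsReverse (v, w) (w, v) 1 :=
  ⟨M.edges_subtree v hv w hw h, M.edges_subtree w hw v hv h.symm, M.action_one _, M.action_one _⟩

/-! ### Gluing: the presentation by a graph of groups -/

section Gluing

variable {H : Type*} [Group H] {Θ : V → G → H} {τ : V × V → G → H}

/-- A compatible family of partial homomorphisms on the vertex groups and on the cosets of stable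
letters of a marking. -/
structure IsCompatible (M : Marking G V) (Θ : V → G → H) (τ : V × V → G → H) : Prop where
  vert_mul : ∀ v ∈ M.verts, ∀ a ∈ M.vertexGroup v, ∀ b ∈ M.vertexGroup v,
    Θ v (a * b) = Θ v a * Θ v b
  edge_mul : ∀ e e' t, M.IsReverse e e' t → ∀ a, M.action a e.1 = e.1 → M.action a e.2 = e.2 →
    τ e (a * t) = Θ e.1 a * τ e t
  edge_inv : ∀ e e' t, M.IsReverse e e' t → τ e' t⁻¹ = (τ e t)⁻¹
  subtree : ∀ v ∈ M.verts, ∀ w ∈ M.verts, M.tree.Adj v w → τ (v, w) 1 = 1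

namespace IsCompatible

theorem vert_one (h : M.IsCompatible Θ τ) {v : V} (hv : v ∈ M.verts) : Θ v 1 = 1 := by
  have := h.vert_mul v hv 1 (one_mem _) 1 (one_mem _)
  simpa using this

theorem vert_inv (h : M.IsCompatible Θ τ) {v : V} (hv : v ∈ M.verts) {a : G}
    (ha : a ∈ M.vertexGroup v) : Θ v a⁻¹ = (Θ v a)⁻¹ := by
  rw [eq_inv_iff_mul_eq_one, ← h.vert_mul v hv _ (inv_mem ha) _ ha, inv_mul_cancel, h.vert_one hv]

/-- Reversing the edge exchanges left and right multiplication. With `edge_mul` this contains the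
relation identifying the two embeddings of the edge group. -/
theorem edge_mul_right (h : M.IsCompatible Θ τ) {e e' : V × V} {t : G} (ht : M.IsReverse e e' t)
    {b : G} (h1 : M.action b e'.1 = e'.1) (h2 : M.action b e'.2 = e'.2) :
    τ e (t * b) = τ e t * Θ e'.1 b := by
  have h3 := h.edge_inv _ _ _ (ht.mul_right h1 h2)
  rw [mul_inv_rev, h.edge_mul _ _ _ ht.symm b⁻¹ (M.action_inv_eq_iff.2 h1.symm)
    (M.action_inv_eq_iff.2 h2.symm), h.vert_inv (M.edges_origin _ ht.mem') h1,
    h.edge_inv _ _ _ ht, ← mul_inv_rev, inv_inj] at h3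
  exact h3.symm

/-- The transition function along an edge of the tree does not depend on choices. -/
theorem transition_eq (h : M.IsCompatible Θ τ) {e e' : V × V} {g g₁ t t₁ γ δ : G}
    (ht : M.IsReverse e e' t) (ht₁ : M.IsReverse e e' t₁)
    (h1 : M.action g₁ e.1 = M.action g e.1) (h2 : M.action g₁ e.2 = M.action g e.2)
    (hγ : M.action γ e.1 = M.action g e.1) (hδ : M.action δ e'.1 = M.action g e.2) :
    Θ e.1 (γ⁻¹ * g₁) * τ e t₁ * (Θ e'.1 (δ⁻¹ * (g₁ * t₁)))⁻¹ =
      Θ e.1 (γ⁻¹ * g) * τ e t * (Θ e'.1 (δ⁻¹ * (g * t)))⁻¹ := by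
  have he := M.edges_origin e ht.mem
  have he' := M.edges_origin e' ht.mem'
  set a := g⁻¹ * g₁ with ha
  have ha1 : M.action a e.1 = e.1 := by rw [ha, action_mul, action_inv_eq_iff, h1]
  have ha2 : M.action a e.2 = e.2 := by rw [ha, action_mul, action_inv_eq_iff, h2]
  set s := t₁ * t⁻¹ with hs
  have hs1 := ht.mul_inv_fst ht₁
  have hs2 := ht.mul_inv_snd ht₁
  have has1 : M.action (a * s) e.1 = e.1 := by rw [action_mul, hs1, ha1]
  have has2 : M.action (a * s) e.2 = e.2 := by rw [action_mul, hs2, ha2]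
  set b := t⁻¹ * (a * s) * t with hb
  have hb1 : M.action b e'.1 = e'.1 := by
    rw [hb, action_mul, action_mul, ht.fst, has2, action_inv_eq_iff, ht.fst]
  have hb2 : M.action b e'.2 = e'.2 := by
    rw [hb, action_mul, action_mul, ht.snd, has1, action_inv_eq_iff, ht.snd]
  have e1 : γ⁻¹ * g₁ = γ⁻¹ * g * a := by rw [ha]; group
  have e2 : t₁ = s * t := by rw [hs]; group
  have e3 : δ⁻¹ * (g₁ * t₁) = δ⁻¹ * (g * t) * b := by rw [hb, hs, ha]; group
  have e4 : a * s * t = t * b := by rw [hb]; group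
  have key : Θ e.1 a * Θ e.1 s * τ e t = τ e t * Θ e'.1 b := by
    rw [← h.vert_mul _ he _ ha1 _ hs1, ← h.edge_mul _ _ _ ht _ has1 has2, e4,
      h.edge_mul_right ht hb1 hb2]
  rw [e3, e1, h.vert_mul _ he _ (M.inv_mul_mem_vertexGroup hγ) _ ha1,
    h.vert_mul _ he' _ (M.inv_mul_mem_vertexGroup (by rw [hδ, action_mul, ht.fst])) _ hb1]
  conv_lhs => rw [e2, h.edge_mul _ _ _ ht _ hs1 hs2]
  rw [mul_inv_rev, mul_assoc (Θ e.1 (γ⁻¹ * g)), ← mul_assoc (Θ e.1 a), key]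
  group

/-- The elements `c x y` form an `H`-valued transition function on the oriented edges of the tree,
inverted by reversal. A tree has no cycles, so it integrates to a potential `f` on the vertices; the
factor `Θ` corrects for the chosen representatives `γ`. -/
theorem exists_section (h : M.IsCompatible Θ τ) : ∃ F : G → V → H,
    (∀ v ∈ M.verts, ∀ g, ∀ a ∈ M.vertexGroup v, F (g * a) v = F g v * Θ v a) ∧
    ∀ e e' t, M.IsReverse e e' t → ∀ g, F (g * t) e'.1 = F g e.1 * τ e t := by
  choose rep hrep _ using fun x => M.verts_transversal x
  choose hrepV γ hγ using hrep
  have hrepeq : ∀ {v : V} {g : G}, v ∈ M.verts → rep (M.action g v) = v := fun {v g} hv =>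
    vert_eq (hrepV _) hv (hγ _)
  have hc : ∀ x y, ∃ c : H, M.tree.Adj x y → ∀ e e' g t, M.IsReverse e e' t →
      M.action g e.1 = x → M.action g e.2 = y →
      c = Θ e.1 ((γ x)⁻¹ * g) * τ e t * (Θ e'.1 ((γ y)⁻¹ * (g * t)))⁻¹ := fun x y => by
    by_cases hxy : M.tree.Adj x y
    · obtain ⟨e, ⟨he, g, h1, h2⟩, -⟩ := M.edges_transversal x y hxy
      obtain ⟨e', t, ht⟩ := exists_isReverse he
      refine ⟨Θ e.1 ((γ x)⁻¹ * g) * τ e t * (Θ e'.1 ((γ y)⁻¹ * (g * t)))⁻¹,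
        fun _ f f' g₁ t₁ ht₁ k1 k2 => ?_⟩
      obtain rfl : e = f := edge_eq he ht₁.mem (h1.trans k1.symm) (h2.trans k2.symm)
      obtain rfl : e' = f' := ht.unique ht₁
      have hx : M.action (γ x) e.1 = M.action g e.1 := by
        have := hγ (M.action g e.1)
        rw [hrepeq (M.edges_origin e he)] at this
        rw [h1] at this ⊢
        exact this
      have hy : M.action (γ y) e'.1 = M.action g e.2 := by
        have := hγ y
        rw [← h2, ← ht.fst, ← action_mul, hrepeq (M.edges_origin e' ht.mem'), action_mul, ht.fst,
          h2] at this
        rw [h2, this]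
      exact (h.transition_eq ht ht₁ (k1.trans h1.symm) (k2.trans h2.symm) hx hy).symm
    · exact ⟨1, fun h => (hxy h).elim⟩
  choose c hc using hc
  obtain ⟨r⟩ := M.isTree.connected.nonempty
  obtain ⟨f, -, hf⟩ := M.isTree.exists_labelling r (P := fun _ _ => True)
    (R := fun x y a b => b = a * c x y) (1 : H) trivial fun x y a _ _ _ => ⟨_, trivial, rfl⟩
  have hcc : ∀ x y, M.tree.Adj x y → c y x = (c x y)⁻¹ := fun x y hxy => by
    obtain ⟨e, ⟨he, g, h1, h2⟩, -⟩ := M.edges_transversal x y hxy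
    obtain ⟨e', t, ht⟩ := exists_isReverse he
    rw [hc x y hxy e e' g t ht h1 h2, hc y x hxy.symm e' e (g * t) t⁻¹ ht.symm
      (by rw [action_mul, ht.fst, h2]) (by rw [action_mul, ht.snd, h1]), h.edge_inv _ _ _ ht,
      mul_inv_cancel_right]
    group
  have hf' : ∀ x y, M.tree.Adj x y → f y = f x * c x y := fun x y hxy => by
    rcases M.isTree.dist_eq_dist_add_one_of_adj r hxy with hd | hd
    · rw [hf y x hxy.symm hd, hcc x y hxy, inv_mul_cancel_right]
    · exact hf x y hxy hd
  have hγmem : ∀ {v : V} {g : G}, v ∈ M.verts → (γ (M.action g v))⁻¹ * g ∈ M.vertexGroup v :=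
    fun {v g} hv => M.inv_mul_mem_vertexGroup (by
      have := hγ (M.action g v)
      rwa [hrepeq hv] at this)
  refine ⟨fun g v => f (M.action g v) * Θ v ((γ (M.action g v))⁻¹ * g), fun v hv g a ha => ?_,
    fun e e' t ht g => ?_⟩
  · have ha' : M.action (g * a) v = M.action g v := by rw [action_mul, show M.action a v = v from ha]
    simp only [ha']
    rw [← mul_assoc, h.vert_mul v hv _ (hγmem hv) _ ha, ← mul_assoc]
  · have hx : M.action (g * t) e'.1 = M.action g e.2 := by rw [action_mul, ht.fst]
    have hadj := (M.adj_action g).2 (M.edges_adj e ht.mem)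
    simp only [hx]
    rw [hf' _ _ hadj, hc _ _ hadj e e' g t ht rfl rfl]
    group

/-- The right factors `Θ` and `τ` cancel in the quotient, so it does not change across an edge;
connectedness of the tree does the rest. -/
theorem section_div_eq {F₁ F₂ : G → V → H}
    (h₁ : ∀ v ∈ M.verts, ∀ g, ∀ a ∈ M.vertexGroup v, F₁ (g * a) v = F₁ g v * Θ v a)
    (h₂ : ∀ v ∈ M.verts, ∀ g, ∀ a ∈ M.vertexGroup v, F₂ (g * a) v = F₂ g v * Θ v a)
    (k₁ : ∀ e e' t, M.IsReverse e e' t → ∀ g, F₁ (g * t) e'.1 = F₁ g e.1 * τ e t)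
    (k₂ : ∀ e e' t, M.IsReverse e e' t → ∀ g, F₂ (g * t) e'.1 = F₂ g e.1 * τ e t)
    {v w : V} (hv : v ∈ M.verts) (hw : w ∈ M.verts) (g h : G) :
    F₁ g v * (F₂ g v)⁻¹ = F₁ h w * (F₂ h w)⁻¹ := by
  have hsame : ∀ {v w : V}, v ∈ M.verts → w ∈ M.verts → ∀ {g h : G},
      M.action g v = M.action h w → F₁ g v * (F₂ g v)⁻¹ = F₁ h w * (F₂ h w)⁻¹ := by
    intro v w hv hw g h hgh
    obtain rfl := vert_eq hv hw hgh
    have hm := M.inv_mul_mem_vertexGroup hgh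
    have : h = g * (g⁻¹ * h) := by group
    rw [this, h₁ v hv g _ hm, h₂ v hv g _ hm]
    group
  have hwalk : ∀ {x y : V}, M.tree.Walk x y → ∀ {v w : V}, v ∈ M.verts → w ∈ M.verts →
      ∀ {g h : G}, M.action g v = x → M.action h w = y →
      F₁ g v * (F₂ g v)⁻¹ = F₁ h w * (F₂ h w)⁻¹ := by
    intro x y p
    induction p with
    | nil =>
      intro v w hv hw g h hg hh
      exact hsame hv hw (hg.trans hh.symm)
    | @cons x y z hxy _ ih =>
      intro v w hv hw g h hg hh
      obtain ⟨e, ⟨he, k, h1, h2⟩, -⟩ := M.edges_transversal x y hxy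
      obtain ⟨e', t, ht⟩ := exists_isReverse he
      rw [hsame hv (M.edges_origin e he) (hg.trans h1.symm),
        ← ih (M.edges_origin e' ht.mem') hw (g := k * t) (by rw [action_mul, ht.fst, h2]) hh,
        k₁ _ _ _ ht, k₂ _ _ _ ht]
      group
  obtain ⟨p⟩ := M.isTree.connected (M.action g v) (M.action h w)
  exact hwalk p hv hw rfl rfl

/-- A compatible family of partial homomorphisms extends to a homomorphism: this is the
presentation of `G` as the fundamental group of the graph of groups of the marking. -/
theorem exists_hom (h : M.IsCompatible Θ τ) : ∃ π : G →* H,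
    (∀ v ∈ M.verts, ∀ a ∈ M.vertexGroup v, π a = Θ v a) ∧
      ∀ e e' t, M.IsReverse e e' t → π t = τ e t := by
  obtain ⟨F, hF, kF⟩ := h.exists_section
  obtain ⟨⟨r, hr⟩⟩ := M.verts_connected.nonempty
  have hconst : ∀ v ∈ M.verts, ∀ g, F g v = F g r := by
    have hwalk : ∀ {x y : M.verts}, (M.tree.induce M.verts).Walk x y → ∀ g, F g x = F g y := by
      intro x y p
      induction p with
      | nil => exact fun _ => rfl
      | @cons x y z hxy _ ih =>
        intro g
        have hadj : M.tree.Adj x y := hxy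
        have := kF _ _ _ (isReverse_one x.2 y.2 hadj) g
        rw [mul_one, h.subtree x x.2 y y.2 hadj, mul_one] at this
        rw [← ih g, this]
    intro v hv g
    obtain ⟨p⟩ := M.verts_connected.preconnected ⟨v, hv⟩ ⟨r, hr⟩
    exact hwalk p g
  set π : G → H := fun g => (F 1 r)⁻¹ * F g r with hπ
  have hmul : ∀ g k, π (g * k) = π g * π k := fun g k => by
    -- Left translation by `g` turns the section `F` into another one, which differs from `F` by a
    -- constant left factor: this is multiplicativity of `π`.
    have := section_div_eq (M := M) (F₁ := fun k v => F (g * k) v) (F₂ := F)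
      (fun v hv k a ha => by rw [← mul_assoc]; exact hF v hv _ a ha) hF
      (fun e e' t ht k => by rw [← mul_assoc]; exact kF e e' t ht _) kF hr hr k 1
    simp only [mul_one] at this
    rw [mul_inv_eq_iff_eq_mul] at this
    simp only [hπ]
    rw [this]
    group
  refine ⟨MonoidHom.mk' π hmul, fun v hv a ha => ?_, fun e e' t ht => ?_⟩
  · have := hF v hv 1 a ha
    rw [one_mul, hconst v hv, hconst v hv] at this
    simp [hπ, this]
  · have := kF e e' t ht 1
    rw [one_mul, hconst _ (M.edges_origin e ht.mem), hconst _ (M.edges_origin e' ht.mem')] at this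
    simp [hπ, this]

end IsCompatible

end Gluing

/-- The stable letters of the edges leaving the subtree have infinite order. -/
theorem IsReverse.orderOf_eq_zero {e e' : V × V} {t : G} (ht : M.IsReverse e e' t)
    (he : e.2 ∉ M.verts) : orderOf t = 0 := by
  classical
  -- The signed count of crossings of `e`. It is trivial on vertex groups and on the subtree, so it
  -- defines a character of `G`, with value `1` on `t`.
  let τ : V × V → G → Multiplicative ℤ := fun f _ =>
    if f = e then Multiplicative.ofAdd 1 else if f = e' then Multiplicative.ofAdd (-1) else 1
  have hτ : M.IsCompatible (fun _ _ => (1 : Multiplicative ℤ)) τ :=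
    { vert_mul := fun _ _ _ _ _ _ => rfl
      edge_mul := fun f f' s _ a _ _ => (one_mul _).symm
      edge_inv := fun f f' s hs => by
        by_cases h1 : f = e
        · subst h1
          obtain rfl := ht.unique hs
          simp [τ, ht.ne.symm]
        by_cases h2 : f = e'
        · subst h2
          obtain rfl := ht.symm.unique hs
          simp [τ, ht.ne.symm]
        have h3 : f' ≠ e := by
          rintro rfl
          exact h2 (hs.symm.unique ht)
        have h4 : f' ≠ e' := by
          rintro rfl
          exact h1 (hs.symm.unique ht.symm)
        simp [τ, h1, h2, h3, h4]
      subtree := fun v hv w hw hvw => by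
        have h1 : (v, w) ≠ e := by rintro rfl; exact he hw
        have h2 : (v, w) ≠ e' := by rintro rfl; exact ht.snd_notMem he hw
        simp [τ, h1, h2] }
  obtain ⟨χ, -, hχ⟩ := hτ.exists_hom
  have h1 : χ t = Multiplicative.ofAdd 1 := by rw [hχ e e' t ht]; simp [τ]
  rw [orderOf_eq_zero_iff']
  intro n hn hpow
  have := congrArg χ hpow
  rw [map_pow, h1, map_one χ, ← ofAdd_nsmul, ← ofAdd_zero] at this
  have := Multiplicative.ofAdd.injective this
  simp at this
  omega

end Marking

/-! ### Homomorphisms on finite subgroups -/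

namespace IsCombinatorial

open HomeoPlus

variable {D₀ : Set UnitAddCircle} {G₀ : Subgroup HomeoPlus} {G : Type*} [Group G]
  {ρ : G →* HomeoPlus}

theorem isCyclic_subgroup (hρ : Function.Injective ρ) (A : Subgroup G) [Finite A] : IsCyclic A :=
  isCyclic_of_injective (ρ := ρ.comp A.subtype) (hρ.comp A.subtype_injective)

/-- A finite group of circle homeomorphisms can be mapped to a combinatorial group, with the same
values on a finite set. -/
theorem exists_hom_agree (hD₀ : Dense D₀) (hG₀ : IsCombinatorial D₀ G₀)
    (hρ : Function.Injective ρ) (A : Subgroup G) [Finite A] {Z : Set UnitAddCircle}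
    (hZ : Z.Finite) (hZD : ∀ a ∈ A, ∀ z ∈ Z, ρ a z ∈ D₀) :
    ∃ β : A →* G₀, (∀ a, rot (β a) = rot (ρ a)) ∧
      ∀ a, ∀ z ∈ Z, (β a : HomeoPlus) z = ρ a z := by
  have := isCyclic_subgroup hρ A
  obtain ⟨α, hα⟩ := IsCyclic.exists_generator (α := A)
  have hfin : IsOfFinOrder (ρ α) := (ρ.comp A.subtype).isOfFinOrder (isOfFinOrder_of_finite α)
  obtain ⟨b, hb1, hb2, hb3⟩ := exists_finite_order_agree hD₀ hG₀ hfin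
    (Z := ⋃ a : A, ρ a '' Z) (Set.finite_iUnion fun a => hZ.image _)
    (Set.iUnion_subset fun a => by rintro _ ⟨z, hz, rfl⟩; exact hZD a a.2 z hz)
    (fun z hz => by
      obtain ⟨a, y, hy, rfl⟩ := Set.mem_iUnion.1 hz
      refine Set.mem_iUnion.2 ⟨α * a, y, hy, ?_⟩
      rw [Subgroup.coe_mul, map_mul]; rfl)
  have hord : orderOf b ∣ orderOf α := by
    rw [← Subgroup.orderOf_coe, hb1, orderOf_injective ρ hρ, Subgroup.orderOf_coe]
  set β : A →* G₀ := monoidHomOfForallMemZpowers hα hord with hβ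
  have hβα : β α = b := monoidHomOfForallMemZpowers_apply_gen hα hord
  have hpow : ∀ a : A, ∃ n : ℕ, α ^ n = a := fun a =>
    (isOfFinOrder_of_finite α).mem_powers_iff_mem_zpowers.2 (hα a)
  refine ⟨β, fun a => ?_, fun a z hz => ?_⟩
  · obtain ⟨n, rfl⟩ := hpow a
    rw [map_pow, hβα, Subgroup.coe_pow, Subgroup.coe_pow, map_pow, rot_pow, rot_pow, hb2]
  · obtain ⟨n, rfl⟩ := hpow a
    rw [map_pow, hβα]
    induction n with
    | zero => simp
    | succ n ih =>
      have h1 : ρ ((α ^ n : A) : G) z ∈ ⋃ a : A, ρ a '' Z := Set.mem_iUnion.2 ⟨α ^ n, z, hz, rfl⟩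
      have h2 : (α ^ (n + 1) : A) = α * α ^ n := pow_succ' α n
      rw [h2, Subgroup.coe_mul, map_mul, HomeoPlus.mul_apply, ← hb3 _ h1, ← ih, pow_succ' b]
      rfl

/-- The homomorphism of `exists_hom_agree` can be chosen to be compatible with one given on
another finite subgroup. -/
theorem exists_hom_extend (hD₀ : Dense D₀) (hG₀ : IsCombinatorial D₀ G₀)
    (hρ : Function.Injective ρ) (A B : Subgroup G) [Finite A] [Finite B]
    {Y Y' : Set UnitAddCircle} (hY' : Y'.Finite) (hYY' : Y ⊆ Y')
    (hBY : ∀ b ∈ B, ∀ y ∈ Y, ρ b y ∈ Y') (hBY' : ∀ b ∈ B, ∀ y ∈ Y', ρ b y ∈ D₀)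
    {β : A →* G₀} (hβ : ∀ a, rot (β a) = rot (ρ a))
    (hβY : ∀ a, ∀ y ∈ Y', (β a : HomeoPlus) y = ρ a y) :
    ∃ γ : B →* G₀, (∀ b, rot (γ b) = rot (ρ b)) ∧
      (∀ b, ∀ y ∈ Y, (γ b : HomeoPlus) y = ρ b y) ∧
      ∀ g (hA : g ∈ A) (hB : g ∈ B), γ ⟨g, hB⟩ = β ⟨g, hA⟩ := by
  obtain ⟨γ, hγ, hγY⟩ := exists_hom_agree hD₀ hG₀ hρ B hY' hBY'
  have : Finite (A ⊓ B : Subgroup G) :=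
    Finite.of_injective _ (Subgroup.inclusion_injective (inf_le_left : A ⊓ B ≤ A))
  have := isCyclic_subgroup hρ (A ⊓ B)
  set σ₁ : (A ⊓ B : Subgroup G) →* G₀ :=
    γ.comp (Subgroup.inclusion (inf_le_right : A ⊓ B ≤ B)) with hσ₁
  set σ₂ : (A ⊓ B : Subgroup G) →* G₀ :=
    β.comp (Subgroup.inclusion (inf_le_left : A ⊓ B ≤ A)) with hσ₂
  have h₁ : ∀ a : (A ⊓ B : Subgroup G), σ₁ a = γ ⟨a, a.2.2⟩ := fun _ => rfl
  have h₂ : ∀ a : (A ⊓ B : Subgroup G), σ₂ a = β ⟨a, a.2.1⟩ := fun _ => rfl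
  -- Conjugation by `η` makes the two homomorphisms agree on `A ⊓ B`. It preserves values only at
  -- points of `Y'` whose image is in `Y'`, hence the smaller set `Y`.
  obtain ⟨η, hη, hconj⟩ := hG₀.exists_conj_agree σ₁ σ₂
    (fun a => by rw [h₁, h₂, hγ, hβ]) 1 hY' (fun a y hy => by
      simp only [one_apply]
      rw [h₁, h₂, hγY _ y hy, hβY _ y hy, and_iff_right (hBY' a a.2.2 y hy)]
      exact ⟨hBY' a a.2.2 y hy, rfl⟩)
  refine ⟨(MulAut.conj η).toMonoidHom.comp γ, fun b => ?_, fun b y hy => ?_, fun g hgA hgB => ?_⟩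
  · rw [← hγ b]
    exact rot_conj _ _
  · change (η : HomeoPlus) ((γ b : HomeoPlus) ((η : HomeoPlus)⁻¹ y)) = _
    have hη' : ∀ x ∈ Y', (η : HomeoPlus) x = x := hη
    rw [inv_apply_eq.2 (hη' y (hYY' hy)).symm, hγY b y (hYY' hy), hη' _ (hBY b b.2 y hy)]
  · have := hconj ⟨g, hgA, hgB⟩
    rw [h₁, h₂] at this
    exact this

end IsCombinatorial

/-! ### Orbits under generators and construction of the homomorphism -/

namespace Marking

open HomeoPlus

variable {G : Type*} [Group G] {V : Type*} (M : Marking G V)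

instance (v : V) : Finite (M.vertexGroup v) := (M.finite_stabilizers v).to_subtype

theorem vertexGroup_subset_gens {v : V} (hv : v ∈ M.verts) {g : G} (hg : g ∈ M.vertexGroup v) :
    g ∈ M.gens :=
  Or.inl ⟨v, hv, hg⟩

theorem one_mem_gens : 1 ∈ M.gens := by
  obtain ⟨⟨r, hr⟩⟩ := M.verts_connected.nonempty
  exact M.vertexGroup_subset_gens hr (one_mem _)

variable {M} in
theorem IsReverse.mem_gens {e e' : V × V} {t : G} (ht : M.IsReverse e e' t) : t ∈ M.gens := by
  by_cases he : e.2 ∈ M.verts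
  · have h1 : e'.1 = e.2 := vert_eq (M.edges_origin e' ht.mem') he (g := t) (h := 1)
      (by rw [ht.fst, action_one])
    exact M.vertexGroup_subset_gens he (by rw [mem_vertexGroup, ← h1, ht.fst, h1])
  · exact Or.inr ⟨e, ht.mem, he, (mem_stableLetters ht.mem).2 ⟨e', ht⟩⟩

theorem edges_finite : M.edges.Finite := by
  refine (M.verts_finite.biUnion fun v _ => (M.locallyFinite v).image fun w => (v, w)).subset ?_
  intro e he
  exact Set.mem_biUnion (M.edges_origin e he) ⟨e.2, M.edges_adj e he, rfl⟩

theorem gens_finite : M.gens.Finite := by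
  have h1 : ∀ x y : V, {g : G | M.action g x = y}.Finite := fun x y => by
    rcases Set.eq_empty_or_nonempty {g : G | M.action g x = y} with h | ⟨g₀, h₀⟩
    · rw [h]; exact Set.finite_empty
    · refine ((M.finite_stabilizers x).image fun h => g₀ * h).subset fun g hg => ?_
      exact ⟨g₀⁻¹ * g, M.inv_mul_mem_vertexGroup (h₀.trans hg.symm), by simp⟩
  refine ((M.verts_finite.biUnion fun v _ => M.finite_stabilizers v).union
    (M.edges_finite.biUnion fun e _ => M.edges_finite.biUnion fun e' _ => h1 e'.2 e.1)).subset ?_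
  rintro g (⟨v, hv, hg⟩ | ⟨e, he, -, e', he', hg, -⟩)
  · exact Or.inl (Set.mem_biUnion hv hg)
  · exact Or.inr (Set.mem_biUnion he (Set.mem_biUnion he' hg))

/-- The points obtained from `P` by applying `n` generators. -/
def gensOrbit (ρ : G →* HomeoPlus) (P : Set UnitAddCircle) : ℕ → Set UnitAddCircle
  | 0 => P
  | n + 1 => ⋃ s ∈ M.gens, ρ s '' gensOrbit ρ P n

section GensOrbit

variable (ρ : G →* HomeoPlus) (P : Set UnitAddCircle)

theorem apply_mem_gensOrbit {s : G} (hs : s ∈ M.gens) {n : ℕ} {x : UnitAddCircle}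
    (hx : x ∈ M.gensOrbit ρ P n) : ρ s x ∈ M.gensOrbit ρ P (n + 1) :=
  Set.mem_biUnion hs ⟨x, hx, rfl⟩

theorem gensOrbit_mono : Monotone (M.gensOrbit ρ P) :=
  monotone_nat_of_le_succ fun n x hx => by
    simpa [one_apply] using M.apply_mem_gensOrbit ρ P M.one_mem_gens hx

theorem gensOrbit_finite (hP : P.Finite) (n : ℕ) : (M.gensOrbit ρ P n).Finite := by
  induction n with
  | zero => exact hP
  | succ n ih => exact M.gens_finite.biUnion fun s _ => ih.image _

theorem gensOrbit_conj (φ : HomeoPlus) (n : ℕ) :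
    M.gensOrbit ((MulAut.conj φ).toMonoidHom.comp ρ) (φ '' P) n = φ '' M.gensOrbit ρ P n := by
  induction n with
  | zero => rfl
  | succ n ih =>
    simp only [gensOrbit, ih, Set.image_iUnion, Set.image_image]
    refine Set.iUnion₂_congr fun s _ => Set.image_congr fun x _ => ?_
    change φ (ρ s (φ⁻¹ (φ x))) = _
    rw [inv_apply_self]

end GensOrbit

section Construction

variable {D₀ : Set UnitAddCircle} {G₀ : Subgroup HomeoPlus} {ρ : G →* HomeoPlus}
  {P : Set UnitAddCircle} {M}

/-- Compatible homomorphisms on the vertex groups, constructed along the subtree. -/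
theorem exists_vertexHoms (hD₀ : Dense D₀) (hG₀ : IsCombinatorial D₀ G₀)
    (hρ : Function.Injective ρ) (hP : P.Finite) {r : M.verts} {K : ℕ}
    (hK : ∀ v, (M.tree.induce M.verts).dist r v ≤ K) (n : ℕ)
    (hPD : M.gensOrbit ρ P (K + n + 1) ⊆ D₀) :
    ∃ β : ∀ v : M.verts, M.vertexGroup v →* G₀, (∀ v a, rot (β v a) = rot (ρ a)) ∧
      (∀ v a, ∀ x ∈ M.gensOrbit ρ P n, (β v a : HomeoPlus) x = ρ a x) ∧
      ∀ v w : M.verts, M.tree.Adj v w → ∀ g (hv : g ∈ M.vertexGroup v) (hw : g ∈ M.vertexGroup w),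
        β v ⟨g, hv⟩ = β w ⟨g, hw⟩ := by
  classical
  set X := M.tree.induce M.verts with hX
  have hXT : X.IsTree := ⟨M.verts_connected, M.isTree.isAcyclic.induce _⟩
  -- The recursion on trees needs one label type for all vertices, so homomorphisms are padded by
  -- `1` outside their domains.
  let ext : ∀ v : M.verts, (M.vertexGroup v →* G₀) → G → G₀ := fun v β g =>
    if h : g ∈ M.vertexGroup v then β ⟨g, h⟩ else 1
  have hext : ∀ (v : M.verts) β g (h : g ∈ M.vertexGroup v), ext v β g = β ⟨g, h⟩ := fun v β g h =>
    dif_pos h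
  -- Each step away from the root costs one level of `gensOrbit`; starting from level `K + n` leaves
  -- at least `n` everywhere.
  let Q : ∀ v : M.verts, (M.vertexGroup v →* G₀) → Prop := fun v β =>
    (∀ a, rot (β a) = rot (ρ a)) ∧ ∀ m, m + X.dist r v = K + n →
      ∀ a, ∀ x ∈ M.gensOrbit ρ P m, (β a : HomeoPlus) x = ρ a x
  have hroot : ∃ β, Q r β := by
    obtain ⟨β, h1, h2⟩ := IsCombinatorial.exists_hom_agree hD₀ hG₀ hρ (M.vertexGroup r)
      (M.gensOrbit_finite ρ P hP (K + n)) (fun a ha z hz => hPD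
        (M.apply_mem_gensOrbit ρ P (M.vertexGroup_subset_gens r.2 ha) hz))
    refine ⟨β, h1, fun m hm => ?_⟩
    rw [SimpleGraph.dist_self, add_zero] at hm
    subst hm
    exact h2
  obtain ⟨β₀, hβ₀⟩ := hroot
  obtain ⟨f, hf, hfR⟩ := hXT.exists_labelling r
    (P := fun v θ => ∃ β, θ = ext v β ∧ Q v β)
    (R := fun v w θ θ' => ∀ g ∈ M.vertexGroup v, g ∈ M.vertexGroup w → θ' g = θ g)
    (ext r β₀) ⟨β₀, rfl, hβ₀⟩ (by
      rintro v w _ hvw hd ⟨β, rfl, hβ1, hβ2⟩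
      obtain ⟨m, hm⟩ : ∃ m, m + X.dist r w = K + n :=
        ⟨K + n - X.dist r w, by have := hK w; omega⟩
      obtain ⟨γ, h1, h2, h3⟩ := IsCombinatorial.exists_hom_extend hD₀ hG₀ hρ (M.vertexGroup v)
        (M.vertexGroup w) (M.gensOrbit_finite ρ P hP (m + 1))
        (M.gensOrbit_mono ρ P (Nat.le_succ m))
        (fun b hb y hy => M.apply_mem_gensOrbit ρ P (M.vertexGroup_subset_gens w.2 hb) hy)
        (fun b hb y hy => hPD (M.gensOrbit_mono ρ P (by omega : m + 1 + 1 ≤ K + n + 1)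
          (M.apply_mem_gensOrbit ρ P (M.vertexGroup_subset_gens w.2 hb) hy)))
        hβ1 (hβ2 (m + 1) (by omega))
      refine ⟨ext w γ, ⟨γ, rfl, h1, fun m' hm' => ?_⟩, fun g hv hw => ?_⟩
      · obtain rfl : m' = m := by omega
        exact h2
      · rw [hext w γ g hw, hext v β g hv, h3 g hv hw])
  choose β hβf hβ using hf
  refine ⟨β, fun v => (hβ v).1, fun v a x hx => ?_, ?_⟩
  · refine (hβ v).2 (K + n - X.dist r v) (by have := hK v; omega) a x
      (M.gensOrbit_mono ρ P (by have := hK v; omega) hx)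
  · have key : ∀ v w : M.verts, X.Adj v w → X.dist r w = X.dist r v + 1 → ∀ g
        (hv : g ∈ M.vertexGroup v) (hw : g ∈ M.vertexGroup w), β w ⟨g, hw⟩ = β v ⟨g, hv⟩ := by
      intro v w hvw hd g hv hw
      have := hfR v w hvw hd g hv hw
      rwa [hβf, hβf, hext _ _ _ hv, hext _ _ _ hw] at this
    intro v w hvw g hv hw
    have hvw' : X.Adj v w := hvw
    rcases hXT.dist_eq_dist_add_one_of_adj r hvw' with hd | hd
    · exact key w v hvw'.symm hd g hw hv
    · exact (key v w hvw' hd g hv hw).symm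

/-- The images of the elements of the coset of stable letters of an edge. -/
structure IsEdgeMap (M : Marking G V) (ρ : G →* HomeoPlus) (P : Set UnitAddCircle)
    (Θ : V → G → G₀) (e e' : V × V) (T : G → G₀) : Prop where
  left : ∀ s, M.IsReverse e e' s → ∀ a, M.action a e.1 = e.1 → M.action a e.2 = e.2 →
    T (a * s) = Θ e.1 a * T s
  right : ∀ s, M.IsReverse e e' s → ∀ b, M.action b e'.1 = e'.1 → M.action b e'.2 = e'.2 →
    T (s * b) = T s * Θ e'.1 b
  agree : ∀ s, M.IsReverse e e' s → ∀ x ∈ P, (T s : HomeoPlus) x = ρ s x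
  agree_inv : ∀ s, M.IsReverse e e' s → ∀ x ∈ P, ((T s)⁻¹ : HomeoPlus) x = ρ s⁻¹ x
  order : e.2 ∉ M.verts → ∀ s, M.IsReverse e e' s → orderOf (T s) = 0
  one : e.2 ∈ M.verts → T 1 = 1

/-- The properties of a family of homomorphisms on the vertex groups that are needed to extend it
to the stable letters. -/
structure IsVertexFamily (M : Marking G V) (ρ : G →* HomeoPlus) (Z : Set UnitAddCircle)
    (Θ : V → G → G₀) : Prop where
  mul : ∀ v ∈ M.verts, ∀ a ∈ M.vertexGroup v, ∀ b ∈ M.vertexGroup v,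
    Θ v (a * b) = Θ v a * Θ v b
  rot : ∀ v ∈ M.verts, ∀ a ∈ M.vertexGroup v, HomeoPlus.rot (Θ v a) = HomeoPlus.rot (ρ a)
  agree : ∀ v ∈ M.verts, ∀ a ∈ M.vertexGroup v, ∀ x ∈ Z, (Θ v a : HomeoPlus) x = ρ a x
  compat : ∀ v ∈ M.verts, ∀ w ∈ M.verts, M.tree.Adj v w → ∀ g ∈ M.vertexGroup v,
    g ∈ M.vertexGroup w → Θ v g = Θ w g

variable {Θ : V → G → G₀} {e e' : V × V} {t : G}

theorem IsVertexFamily.one {Z : Set UnitAddCircle} (h : M.IsVertexFamily ρ Z Θ) {v : V}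
    (hv : v ∈ M.verts) : Θ v 1 = 1 := by
  have := h.mul v hv 1 (one_mem _) 1 (one_mem _)
  simpa using this

theorem IsVertexFamily.inv {Z : Set UnitAddCircle} (h : M.IsVertexFamily ρ Z Θ) {v : V}
    (hv : v ∈ M.verts) {a : G} (ha : a ∈ M.vertexGroup v) : Θ v a⁻¹ = (Θ v a)⁻¹ := by
  rw [eq_inv_iff_mul_eq_one, ← h.mul v hv _ (inv_mem ha) _ ha, inv_mul_cancel, h.one hv]

theorem IsVertexFamily.isOfFinOrder {Z : Set UnitAddCircle} (h : M.IsVertexFamily ρ Z Θ) {v : V}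
    (hv : v ∈ M.verts) {a : G} (ha : a ∈ M.vertexGroup v) :
    IsOfFinOrder (Θ v a : HomeoPlus) := by
  let σ : M.vertexGroup v →* G₀ := MonoidHom.mk' (fun a => Θ v a)
    fun a b => h.mul v hv a a.2 b b.2
  exact (G₀.subtype.comp σ).isOfFinOrder (isOfFinOrder_of_finite ⟨a, ha⟩)

theorem IsVertexFamily.orderOf_eq {Z : Set UnitAddCircle} (h : M.IsVertexFamily ρ Z Θ)
    (hρ : Function.Injective ρ) {v : V} (hv : v ∈ M.verts) {a : G} (ha : a ∈ M.vertexGroup v) :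
    orderOf (Θ v a) = orderOf a := by
  have hfin : IsOfFinOrder (ρ a) :=
    (ρ.comp (M.vertexGroup v).subtype).isOfFinOrder (isOfFinOrder_of_finite ⟨a, ha⟩)
  rw [← Subgroup.orderOf_coe, ← addOrderOf_rot (h.isOfFinOrder hv ha), h.rot v hv a ha,
    addOrderOf_rot hfin, orderOf_injective ρ hρ]

/-- Reversed edges carry the inverse letters, so their images must be the inverses; the field
`agree_inv` secures the values of these on `P`. -/
theorem IsEdgeMap.symm {T : G → G₀} (ht : M.IsReverse e e' t) (h : M.IsEdgeMap ρ P Θ e e' T)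
    {Z : Set UnitAddCircle} (hΘ : M.IsVertexFamily ρ Z Θ) :
    M.IsEdgeMap ρ P Θ e' e (fun s => (T s⁻¹)⁻¹) where
  left s hs a h1 h2 := by
    rw [mul_inv_rev, h.right _ hs.symm _ (M.action_inv_eq_iff.2 h1.symm)
      (M.action_inv_eq_iff.2 h2.symm), hΘ.inv (M.edges_origin _ ht.mem') h1]
    group
  right s hs b h1 h2 := by
    rw [mul_inv_rev, h.left _ hs.symm _ (M.action_inv_eq_iff.2 h1.symm)
      (M.action_inv_eq_iff.2 h2.symm), hΘ.inv (M.edges_origin _ ht.mem) h1]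
    group
  agree s hs x hx := by simpa using h.agree_inv _ hs.symm x hx
  agree_inv s hs x hx := by simpa using h.agree _ hs.symm x hx
  order he s hs := by
    rw [orderOf_inv]
    exact h.order (hs.symm.symm.snd_notMem he) _ hs.symm
  one he := by
    rw [inv_one, h.one (by_contra fun h' => ht.snd_notMem h' he), inv_one]

/-- For a subtree edge the coset is the edge group, and `Θ` serves. Otherwise one `η` intertwining
the embeddings `σ₁`, `σ₂` of the edge group determines the map on the coset; multiplying it by an
element centralizing `σ₁` makes all these images of infinite order at once. -/
theorem exists_isEdgeMap (hD₀ : Dense D₀) (hG₀ : IsCombinatorial D₀ G₀)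
    (hρ : Function.Injective ρ) (hP : P.Finite) (hPD : M.gensOrbit ρ P 2 ⊆ D₀)
    (hΘ : M.IsVertexFamily ρ (M.gensOrbit ρ P 2) Θ) (ht : M.IsReverse e e' t) :
    ∃ T, M.IsEdgeMap ρ P Θ e e' T := by
  have hv := M.edges_origin e ht.mem
  have hw := M.edges_origin e' ht.mem'
  have hP2 : P ⊆ M.gensOrbit ρ P 2 := M.gensOrbit_mono ρ P (Nat.zero_le 2)
  have h12 : M.gensOrbit ρ P 1 ⊆ M.gensOrbit ρ P 2 := M.gensOrbit_mono ρ P (Nat.le_succ 1)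
  by_cases he : e.2 ∈ M.verts
  · have h1 : e'.1 = e.2 := vert_eq hw he (g := t) (h := 1) (by rw [ht.fst, action_one])
    have h2 : e' = (e.2, e.1) := edge_eq ht.mem' (M.edges_subtree _ he _ hv
      (M.edges_adj e ht.mem).symm) (g := t) (h := 1) (by simp [ht.fst])
      (by simp [ht.snd])
    have h3 : e'.2 = e.1 := by rw [h2]
    have hs : ∀ s, M.IsReverse e e' s → s ∈ M.vertexGroup e.1 := fun s hs => by
      have := hs.snd
      rwa [h3] at this
    refine ⟨Θ e.1, ⟨fun s hs' a ha _ => hΘ.mul _ hv _ ha _ (hs s hs'), fun s hs' b hb1 hb2 => ?_,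
      fun s hs' x hx => hΘ.agree _ hv _ (hs s hs') x (hP2 hx), fun s hs' x hx => ?_,
      fun h => (h he).elim, fun _ => hΘ.one hv⟩⟩
    · rw [h3] at hb2
      rw [hΘ.mul _ hv _ (hs s hs') _ hb2, hΘ.compat _ hv _ hw (by
        rw [h1]; exact M.edges_adj e ht.mem) b hb2 hb1]
    · rw [← Subgroup.coe_inv, ← hΘ.inv hv (hs s hs')]
      exact hΘ.agree _ hv _ (inv_mem (hs s hs')) x (hP2 hx)
  · set A : Subgroup G := M.vertexGroup e.1 ⊓ M.vertexGroup e.2 with hA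
    have : Finite A :=
      Finite.of_injective _ (Subgroup.inclusion_injective (inf_le_left : A ≤ M.vertexGroup e.1))
    have := IsCombinatorial.isCyclic_subgroup hρ A
    have hconj : ∀ a ∈ A, t⁻¹ * a * t ∈ M.vertexGroup e'.1 := fun a ha => by
      rw [mem_vertexGroup, action_mul, action_mul, ht.fst, show M.action a e.2 = e.2 from ha.2,
        action_inv_eq_iff, ht.fst]
    let σ₁ : A →* G₀ := MonoidHom.mk' (fun a => Θ e'.1 (t⁻¹ * a * t)) fun a b => by
      rw [← hΘ.mul _ hw _ (hconj a a.2) _ (hconj b b.2)]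
      congr 1
      rw [Subgroup.coe_mul]; group
    let σ₂ : A →* G₀ := MonoidHom.mk' (fun a => Θ e.1 a) fun a b =>
      hΘ.mul _ hv _ a.2.1 _ b.2.1
    have hσ₁ : ∀ a : A, σ₁ a = Θ e'.1 (t⁻¹ * a * t) := fun _ => rfl
    have hσ₂ : ∀ a : A, σ₂ a = Θ e.1 a := fun _ => rfl
    have hrot₁ : ∀ a : A, rot (σ₁ a) = rot (ρ a) := fun a => by
      rw [hσ₁, hΘ.rot _ hw _ (hconj a a.2), map_mul, map_mul, map_inv]
      have := rot_conj (ρ a) (ρ t)⁻¹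
      rwa [inv_inv] at this
    have hinj : Function.Injective σ₁ := (injective_iff_map_eq_one σ₁).2 fun a ha => by
      have h1 := hrot₁ a
      rw [ha, Subgroup.coe_one, rot_one] at h1
      have h2 := eq_one_of_rot_eq_zero
        ((ρ.comp A.subtype).isOfFinOrder (isOfFinOrder_of_finite a)) h1.symm
      exact Subtype.ext ((injective_iff_map_eq_one ρ).1 hρ a h2)
    have hgens : ∀ a ∈ A, a * t ∈ M.gens := fun a ha =>
      (ht.mul_left (show M.action a e.1 = e.1 from ha.1) ha.2).mem_gens
    obtain ⟨η₀, hη₀, hη₀c⟩ := hG₀.exists_conj_agree σ₁ σ₂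
      (fun a => (hrot₁ a).trans (hΘ.rot _ hv a a.2.1).symm) (ρ t)
      (M.gensOrbit_finite ρ P hP 1) (fun a x hx => by
        have h1 : (σ₁ a : HomeoPlus) x = ρ (t⁻¹ * a * t) x :=
          hΘ.agree _ hw _ (hconj a a.2) x (h12 hx)
        have h2 : ρ t ((σ₁ a : HomeoPlus) x) = ρ (a * t) x := by
          rw [h1, ← HomeoPlus.mul_apply, ← map_mul]
          congr 3
          group
        refine ⟨hG₀.apply_mem _ (hPD (h12 hx)), ?_, ?_⟩
        · rw [h2]
          exact hPD (M.apply_mem_gensOrbit ρ P (hgens a a.2) hx)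
        · rw [h2, hσ₂, hΘ.agree _ hv a a.2.1 _ (M.apply_mem_gensOrbit ρ P ht.mem_gens hx),
            map_mul, HomeoPlus.mul_apply])
    obtain ⟨ζ, hζc, hζ, hζo⟩ := hG₀.exists_commute_forall_orderOf_eq_zero hD₀ hinj
      (Set.finite_range σ₂) (M.gensOrbit_finite ρ P hP 1) (h12.trans hPD) η₀
    obtain ⟨η, hη⟩ : ∃ η, η = η₀ * ζ := ⟨_, rfl⟩
    have hηx : ∀ x ∈ M.gensOrbit ρ P 1, (η : HomeoPlus) x = ρ t x := fun x hx => by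
      rw [hη, Subgroup.coe_mul, HomeoPlus.mul_apply, hζ x hx, hη₀ x hx]
    have hηc : ∀ a : A, σ₂ a * η = η * σ₁ a := fun a => by
      rw [← hη₀c, hη, mul_assoc η₀ ζ, (hζc a).eq]
      group
    have hmem : ∀ s, M.IsReverse e e' s → s * t⁻¹ ∈ A := fun s hs =>
      ⟨ht.mul_inv_fst hs, ht.mul_inv_snd hs⟩
    refine ⟨fun s => Θ e.1 (s * t⁻¹) * η, ⟨fun s hs a ha1 ha2 => ?_, fun s hs b hb1 hb2 => ?_,
      fun s hs x hx => ?_, fun s hs x hx => ?_, fun _ s hs => ?_, fun h => (he h).elim⟩⟩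
    · rw [mul_assoc a, hΘ.mul _ hv _ ha1 _ (hmem s hs).1, mul_assoc]
    · have hbA : t * b * t⁻¹ ∈ A := hmem _ (ht.mul_right hb1 hb2)
      have h1 := hηc ⟨_, hbA⟩
      rw [hσ₁, hσ₂] at h1
      have h2 : t⁻¹ * (t * b * t⁻¹) * t = b := by group
      simp only [h2] at h1
      have h3 : s * b * t⁻¹ = s * t⁻¹ * (t * b * t⁻¹) := by group
      rw [h3, hΘ.mul _ hv _ (hmem s hs).1 _ hbA.1, mul_assoc, h1, mul_assoc]
    · have hx1 : x ∈ M.gensOrbit ρ P 1 := M.gensOrbit_mono ρ P (Nat.zero_le 1) hx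
      rw [Subgroup.coe_mul, HomeoPlus.mul_apply, hηx x hx1,
        hΘ.agree _ hv _ (hmem s hs).1 _ (M.apply_mem_gensOrbit ρ P ht.mem_gens hx1),
        ← HomeoPlus.mul_apply, ← map_mul, inv_mul_cancel_right]
    -- Inverses lead to evaluating `η` at the points `ρ s⁻¹ x`, which is why it was prescribed on
    -- level `1` and not only on `P`.
    · rw [inv_apply_eq, Subgroup.coe_mul, HomeoPlus.mul_apply,
        hηx _ (M.apply_mem_gensOrbit ρ P hs.symm.mem_gens hx), ← HomeoPlus.mul_apply (ρ t), ← map_mul,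
        ← inv_apply_eq, ← Subgroup.coe_inv, ← hΘ.inv hv (hmem s hs).1,
        hΘ.agree _ hv _ (inv_mem (hmem s hs).1) x (hP2 hx), mul_inv_rev, inv_inv]
    · have := hζo (σ₂ ⟨_, hmem s hs⟩) ⟨_, rfl⟩
      rwa [mul_assoc, ← hη] at this

/-- A faithful action of a marked group on the circle can be replaced by an action through a
combinatorial group, with the same values of the generators at finitely many points, provided that
the images of these points under sufficiently long products of generators are in `D₀`. -/
theorem exists_hom_agree (M : Marking G V) (hD₀ : Dense D₀) (hG₀ : IsCombinatorial D₀ G₀) :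
    ∃ N : ℕ, ∀ ρ : G →* HomeoPlus, Function.Injective ρ → ∀ P : Set UnitAddCircle, P.Finite →
      M.gensOrbit ρ P N ⊆ D₀ → ∃ π : G →* G₀, ∀ s ∈ M.gens, orderOf (π s) = orderOf s ∧
        ∀ x ∈ P, (π s : HomeoPlus) x = ρ s x := by
  classical
  obtain ⟨r⟩ := M.verts_connected.nonempty
  have := M.verts_finite.to_subtype
  obtain ⟨K, hK⟩ := (Set.finite_range fun v => (M.tree.induce M.verts).dist r v).bddAbove
  replace hK : ∀ v, (M.tree.induce M.verts).dist r v ≤ K := fun v => hK ⟨v, rfl⟩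
  -- `K` levels are spent along the subtree, `2` are kept for the stable letters, and one more puts
  -- the images under vertex groups in `D₀`. The bound depends on neither `ρ` nor `P`.
  refine ⟨K + 2 + 1, fun ρ hρ P hP hPD => ?_⟩
  obtain ⟨β, hβ1, hβ2, hβ3⟩ := exists_vertexHoms hD₀ hG₀ hρ hP hK 2 hPD
  let Θ : V → G → G₀ := fun v g =>
    if h : ∃ hv : v ∈ M.verts, g ∈ M.vertexGroup v then β ⟨v, h.1⟩ ⟨g, h.2⟩ else 1
  have hΘβ : ∀ v (hv : v ∈ M.verts) g (hg : g ∈ M.vertexGroup v), Θ v g = β ⟨v, hv⟩ ⟨g, hg⟩ :=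
    fun v hv g hg => dif_pos ⟨hv, hg⟩
  have hΘ : M.IsVertexFamily ρ (M.gensOrbit ρ P 2) Θ :=
    { mul := fun v hv a ha b hb => by
        rw [hΘβ v hv a ha, hΘβ v hv b hb, hΘβ v hv _ (mul_mem ha hb), ← map_mul]; rfl
      rot := fun v hv a ha => by rw [hΘβ v hv a ha]; exact hβ1 _ _
      agree := fun v hv a ha x hx => by rw [hΘβ v hv a ha]; exact hβ2 _ _ x hx
      compat := fun v hv w hw hvw g hgv hgw => by
        rw [hΘβ v hv g hgv, hΘβ w hw g hgw]
        exact hβ3 ⟨v, hv⟩ ⟨w, hw⟩ hvw g hgv hgw }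
  have hPD2 : M.gensOrbit ρ P 2 ⊆ D₀ := (M.gensOrbit_mono ρ P (by omega)).trans hPD
  have hrev : ∀ e, ∃ e', ∀ e'' t, M.IsReverse e e'' t → e'' = e' := fun e => by
    by_cases h : ∃ e'' t, M.IsReverse e e'' t
    · obtain ⟨e', t, ht⟩ := h
      exact ⟨e', fun e'' s hs => hs.unique ht⟩
    · exact ⟨e, fun e'' s hs => (h ⟨e'', s, hs⟩).elim⟩
  choose rev hrev using hrev
  have hT : ∀ e, ∃ T : G → G₀, ∀ e' t, M.IsReverse e e' t → M.IsEdgeMap ρ P Θ e e' T := fun e => by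
    by_cases h : ∃ e' t, M.IsReverse e e' t
    · obtain ⟨e', t, ht⟩ := h
      obtain ⟨T, hT⟩ := exists_isEdgeMap hD₀ hG₀ hρ hP hPD2 hΘ ht
      refine ⟨T, fun e'' s hs => ?_⟩
      rwa [hs.unique ht]
    · exact ⟨1, fun e'' s hs => (h ⟨e'', s, hs⟩).elim⟩
  choose T hT using hT
  -- The well-ordering selects one edge from each reversal pair, whose members are distinct as there
  -- are no inversions. The other edge receives the inverses, so `edge_inv` holds by construction.
  let τ : V × V → G → G₀ := fun e =>
    if WellOrderingRel e (rev e) then T e else fun s => (T (rev e) s⁻¹)⁻¹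
  have hτ : ∀ e e' t, M.IsReverse e e' t → M.IsEdgeMap ρ P Θ e e' (τ e) := fun e e' t ht => by
    by_cases h : WellOrderingRel e (rev e)
    · simp only [τ, if_pos h]; exact hT e e' t ht
    · simp only [τ, if_neg h]
      rw [← hrev e e' t ht]
      exact (hT e' e _ ht.symm).symm ht.symm hΘ
  have hcompat : M.IsCompatible Θ τ :=
    { vert_mul := hΘ.mul
      edge_mul := fun e e' t ht a h1 h2 => (hτ e e' t ht).left t ht a h1 h2
      edge_inv := fun e e' t ht => by
        have h1 := hrev e e' t ht
        have h2 := hrev e' e _ ht.symm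
        rcases trichotomous_of WellOrderingRel e e' with h | h | h
        · have h' : ¬ WellOrderingRel e' e := fun h' => asymm h h'
          simp only [τ]
          rw [← h1, ← h2, if_pos h, if_neg h', inv_inv]
        · exact (ht.ne h).elim
        · have h' : ¬ WellOrderingRel e e' := fun h' => asymm h h'
          simp only [τ]
          rw [← h1, ← h2, if_pos h, if_neg h', inv_inv]
      subtree := fun v hv w hw hvw => (hτ _ _ _ (isReverse_one hv hw hvw)).one hw }
  obtain ⟨π, hπ1, hπ2⟩ := hcompat.exists_hom
  refine ⟨π, ?_⟩
  rintro s (⟨v, hv, hs⟩ | ⟨e, he, hev, hs⟩)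
  · rw [hπ1 v hv s hs]
    exact ⟨hΘ.orderOf_eq hρ hv hs, fun x hx =>
      hΘ.agree v hv s hs x (M.gensOrbit_mono ρ P (Nat.zero_le 2) hx)⟩
  · obtain ⟨e', ht⟩ := (mem_stableLetters he).1 hs
    rw [hπ2 e e' s ht]
    exact ⟨by rw [(hτ e e' s ht).order hev s ht, ht.orderOf_eq_zero hev],
      (hτ e e' s ht).agree s ht⟩

end Construction

end Marking

/-! ### Finite orbits and the final perturbation -/

namespace HomeoPlus

/-- A continuous lift with translation number `p / q` satisfies `F ^ q t = t + p` at some `t`. -/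
theorem exists_finite_orbit {f : HomeoPlus} (hf : HasRationalRot f) :
    ∃ O : Set UnitAddCircle, O.Finite ∧ O.Nonempty ∧ ∀ x ∈ O, f x ∈ O := by
  obtain ⟨r, hr⟩ := hf
  obtain ⟨F, hF⟩ := exists_isLift f
  rw [rot_eq_of_isLift hF] at hr
  obtain ⟨k, hk⟩ := coe_eq_coe_iff.1 hr
  have hden : (r.den : ℝ) ≠ 0 := by exact_mod_cast r.den_nz
  have hτ : CircleDeg1Lift.translationNumber (F : CircleDeg1Lift) =
      ((r.num + k * r.den : ℤ) : ℝ) / (r.den : ℕ) := by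
    have h : (r : ℝ) = r.num / r.den := by exact_mod_cast (Rat.num_div_den r).symm
    rw [hk, h]
    push_cast
    field_simp
  obtain ⟨t, ht⟩ := ((F : CircleDeg1Lift).translationNumber_eq_rat_iff (continuous_unit F)
    r.den_pos).1 hτ
  have hper : (f ^ r.den) (t : UnitAddCircle) = t := by
    rw [hF.pow r.den t, coe_eq_coe_iff]
    exact ⟨_, by rw [← ht]; simp⟩
  refine ⟨(fun n : ℕ => (f ^ n) (t : UnitAddCircle)) '' Set.Iio r.den,
    (Set.finite_Iio _).image _, ⟨_, 0, r.den_pos, rfl⟩, ?_⟩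
  rintro _ ⟨n, hn, rfl⟩
  rw [Set.mem_Iio] at hn
  rcases (Nat.succ_le_of_lt hn).lt_or_eq with h | h
  · exact ⟨n + 1, h, pow_succ_apply f n _⟩
  · refine ⟨0, r.den_pos, ?_⟩
    have h' : n + 1 = r.den := h
    simp only
    rw [← pow_succ_apply, h', hper]
    rfl

end HomeoPlus

open HomeoPlus in
theorem mainTheorem9
    (D₀ : Set UnitAddCircle) (hD₀ : Dense D₀)
    (G₀ : Subgroup HomeoPlus) (hG₀ : IsCombinatorial D₀ G₀)
    (G : Subgroup HomeoPlus) {V : Type*} (M : Marking G V)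
    (ε : ℝ) (hε : 0 < ε)
    (P : Set UnitAddCircle) (hP : P.Finite) (hPD₀ : P ⊆ D₀)
    (hGP : ∀ s ∈ M.gens, ∀ t ∈ M.gens, ∀ p ∈ P, (s : HomeoPlus) ((t : HomeoPlus) p) ∈ D₀) :
    ∃ π : G →* G₀,
      (∀ s ∈ M.gens, orderOf (π s) = orderOf s ∧
        (HomeoPlus.HasRationalRot (s : HomeoPlus) →
          HomeoPlus.rot (π s : HomeoPlus) = HomeoPlus.rot (s : HomeoPlus))) ∧
      (∀ s ∈ M.gens, HomeoPlus.uniformDist (π s : HomeoPlus) (s : HomeoPlus) < ε) ∧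
      (∀ s ∈ M.gens, ∀ p ∈ P, (π s : HomeoPlus) p = (s : HomeoPlus) p) ∧
      (∀ v ∈ M.verts, ∀ s ∈ M.vertexGroup v, ∀ g ∈ M.vertexGroup v, ∀ p ∈ P,
        (π s : HomeoPlus) ((g : HomeoPlus) p) = (s : HomeoPlus) ((g : HomeoPlus) p)) := by
  obtain ⟨N, hN⟩ := M.exists_hom_agree hD₀ hG₀
  choose S hSD hSfin hS using fun s : G =>
    exists_finite_uniformDist_lt hD₀ (s : HomeoPlus) (half_pos hε)
  have hO : ∀ s : G, ∃ O : Set UnitAddCircle, O.Finite ∧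
      (HasRationalRot (s : HomeoPlus) → O.Nonempty) ∧ ∀ x ∈ O, (s : HomeoPlus) x ∈ O := fun s => by
    by_cases h : HasRationalRot (s : HomeoPlus)
    · obtain ⟨O, h1, h2, h3⟩ := exists_finite_orbit h
      exact ⟨O, h1, fun _ => h2, h3⟩
    · exact ⟨∅, Set.finite_empty, fun h' => (h h').elim, by simp⟩
  choose O hOfin hOne hOinv using hO
  -- `S s` controls the distance to `s` and `O s` its rotation number; the finite orbits `O s` need
  -- not lie in `D₀`.
  set P₁ : Set UnitAddCircle := P ∪ (⋃ s ∈ M.gens, S s) ∪ ⋃ s ∈ M.gens, O s with hP₁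
  have hP₁fin : P₁.Finite := (hP.union (M.gens_finite.biUnion fun s _ => hSfin s)).union
    (M.gens_finite.biUnion fun s _ => hOfin s)
  set Q : Set UnitAddCircle := P ∪ (⋃ s ∈ M.gens, S s) ∪ ⋃ s ∈ M.gens, (s : HomeoPlus) '' P with hQ
  have hQfin : Q.Finite := (hP.union (M.gens_finite.biUnion fun s _ => hSfin s)).union
    (M.gens_finite.biUnion fun s _ => hP.image _)
  have hQD : Q ⊆ D₀ := by
    refine Set.union_subset (Set.union_subset hPD₀ (Set.iUnion₂_subset fun s _ => hSD s))
      (Set.iUnion₂_subset fun s hs => ?_)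
    rintro _ ⟨p, hp, rfl⟩
    exact hGP s hs 1 M.one_mem_gens p hp
  -- `φ` can be chosen for level `N` because `N` is the same for all conjugates of the action. With
  -- `q = 1` the commutation condition is empty.
  obtain ⟨φ, hφQ, hφD, -, hφε⟩ := exists_move hD₀ one_pos
    (fun d hd x hx => by
      rw [one_smul, sub_eq_zero] at hx
      rwa [hx]) hQfin hQD (M.gensOrbit_finite G.subtype P₁ hP₁fin N) (half_pos hε)
  set ρ : G →* HomeoPlus := (MulAut.conj φ).toMonoidHom.comp G.subtype with hρ
  have hρφ : ∀ (s : G) x, ρ s (φ x) = φ ((s : HomeoPlus) x) := fun s x => by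
    change φ ((s : HomeoPlus) (φ⁻¹ (φ x))) = _
    rw [inv_apply_self]
  have hρinj : Function.Injective ρ := (MulAut.conj φ).injective.comp G.subtype_injective
  obtain ⟨π, hπ⟩ := hN ρ hρinj (φ '' P₁) (hP₁fin.image _) (by
    rw [hρ, M.gensOrbit_conj]
    rintro _ ⟨x, hx, rfl⟩
    exact hφD x hx)
  have hπφ : ∀ s ∈ M.gens, ∀ x ∈ P₁, (π s : HomeoPlus) (φ x) = φ ((s : HomeoPlus) x) :=
    fun s hs x hx => ((hπ s hs).2 _ ⟨x, hx, rfl⟩).trans (hρφ s x)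
  have hsP : ∀ s ∈ M.gens, ∀ p ∈ P, φ ((s : HomeoPlus) p) = (s : HomeoPlus) p := fun s hs p hp =>
    hφQ _ (Or.inr (Set.mem_biUnion hs ⟨p, hp, rfl⟩))
  have hπP : ∀ s ∈ M.gens, ∀ p ∈ P, (π s : HomeoPlus) p = (s : HomeoPlus) p := fun s hs p hp => by
    have h1 := hπφ s hs p (Or.inl (Or.inl hp))
    rwa [hφQ p (Or.inl (Or.inl hp)), hsP s hs p hp] at h1
  refine ⟨π, fun s hs => ⟨(hπ s hs).1, fun hrat => ?_⟩, fun s hs => ?_, hπP,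
    fun v hv s hs g hg p hp => ?_⟩
  · rw [← rot_conj (s : HomeoPlus) φ]
    refine rot_eq_of_agree (S := φ '' O s) ((hOne s hrat).image _) ?_ ?_
    · rintro _ ⟨x, hx, rfl⟩
      exact (hπφ s hs x (Or.inr (Set.mem_biUnion hs hx))).trans (hρφ s x).symm
    · rintro _ ⟨x, hx, rfl⟩
      exact ⟨_, hOinv s x hx, (hρφ s x).symm⟩
  -- As `φ` fixes `S s`, the map `φ⁻¹ * π s` has the values of `s` there; the other half of `ε` pays
  -- for `φ`.
  · have hclose : uniformDist (φ⁻¹ * (π s : HomeoPlus)) (s : HomeoPlus) < ε / 2 := by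
      refine hS s _ fun x hx => ?_
      have hxS : x ∈ ⋃ s ∈ M.gens, S s := Set.mem_biUnion hs hx
      have h1 := hπφ s hs x (Or.inl (Or.inr hxS))
      rw [hφQ x (Or.inl (Or.inr hxS))] at h1
      rw [mul_apply, h1, inv_apply_self]
    rw [uniformDist_lt_iff hε]
    rw [uniformDist_lt_iff (half_pos hε)] at hclose
    intro x
    have h1 := hφε ((φ⁻¹ * (π s : HomeoPlus)) x)
    rw [mul_apply, apply_inv_self] at h1
    have h2 := hclose x
    rw [mul_apply] at h2
    linarith [dist_triangle ((π s : HomeoPlus) x) (φ⁻¹ ((π s : HomeoPlus) x)) ((s : HomeoPlus) x)]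
  -- The value of `π s` at `g p` follows from those of `π (s * g)` and `π g` at `p`, since `s * g`
  -- is again in the vertex group.
  · have h1 := hπP g (M.vertexGroup_subset_gens hv hg) p hp
    have h2 := hπP (s * g) (M.vertexGroup_subset_gens hv (mul_mem hs hg)) p hp
    rw [map_mul] at h2
    change (π s : HomeoPlus) ((π g : HomeoPlus) p) = (s : HomeoPlus) ((g : HomeoPlus) p) at h2
    rwa [h1] at h2
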